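/- Let $\mathbf r=\{r_n\}_{n\ge 0}$ be a sequence with $r_n\in(0,1)$ for all $n$. **Slit carpet.** For a dyadic square $\Delta=[\frac{i}{2^n},\frac{i+1}{2^n}]\times[\frac{j}{2^n},\frac{j+1}{2^n}]$ of generation $n\ge 0$ ($0\le i,j<2^n$) with centre $(x,y)$, let $s(\Delta)=\{x\}\times[y-\frac{r_n}{2^{n+1}},y+\frac{r_n}{2^{n+1}}]$ be its slit, of length $l(s(\Delta))=r_n2^{-n}$. Let $S_n$ be $(0,1)^2$ minus all slits of generation less than $n$, with its path metric (the infimum of the lengths of curves in $S_n$ joining two points), and let $\mathscr S_n$ be its completion. The inclusions $S_{n+1}\subset S_n$ extend to $1$-Lipschitz maps $\mathscr S_{n+1}\to\mathscr S_n$. The slit carpet $\mathscr S=\mathscr S_{\mathbf r}$ is the inverse limit of the $\mathscr S_n$, with the metric $d_{\mathscr S}(p,q)=\lim_n d_{\mathscr S_n}(p_n,q_n)$, and $\pi:\mathscr S\to\mathscr S_0=[0,1]^2$ is the projection. Let $D\mathscr S$ be the double of $\mathscr S$: two copies of $\mathscr S$ in which points with the same projection on $\partial[0,1]^2$ are identified,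 with the quotient metric. For a point $z$ of a slit, let $p_z^{+}$ (respectively $p_z^-$) be the point of $\pi^{-1}(z)$ on the right (respectively left) side of the slit, that is, the point of $\pi^{-1}(z)$ in the closure of the set of points of $\mathscr S$ whose projection lies strictly to the right (left) of the vertical line through $z$. **Pillowcases.** For $l>0$ let $\mathscr P(l)$ be the square pillowcase of sidelength $l$: the quotient of the Euclidean rectangle $[-l,l]\times[0,l]$ by $(x,0)\sim(-x,0)$ and $(x,l)\sim(-x,l)$, with the quotient metric. Its boundary $\partial\mathscr P(l)$ is the image of the two vertical sides of the rectangle. **Gluing.** Let $\mathscr D$ be the quotient of the disjoint union of $D\mathscr S$ and of one pillowcase $\mathscr P_j=\mathscr P(l(s_j))$ for each slit $s_j$ of each of the two copies of $\mathscr S$, where for the slit $s_j$ over $\{x\}\times[a,a+l]$ the boundary point $[(l,t)]\in\partial\mathscr P_j$ is identified with $p^+_{(x,a+t)}$ and $[(-l,t)]$ with $p^-_{(x,a+t)}$, in the same copy of $\mathscr S$, for $0\le t\le l$. Let $\tau(p,q)$ be $d_{D\mathscr S}(p,q)$ if $p,q\in D\mathscr S$; $d_{\mathscr P_i}(p,q)$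 if $p,q\in\mathscr P_i$; $\inf_{\zeta\in s_i}\big(d_{D\mathscr S}(p,\zeta)+d_{\mathscr P_i}(\zeta,q)\big)$ if $p\in D\mathscr S$, $q\in\mathscr P_i$ (and symmetrically); and $\inf_{\zeta\in s_i,\,\xi\in s_j}\big(d_{\mathscr P_i}(p,\zeta)+d_{D\mathscr S}(\zeta,\xi)+d_{\mathscr P_j}(\xi,q)\big)$ if $p\in\mathscr P_i$, $q\in\mathscr P_j$, $i\ne j$. Put $d_{\mathscr D}(p,q)=\inf\sum_{k=1}^n\tau(\zeta_k,\xi_k)$, the infimum being over all finite sequences $\zeta_1,\xi_1,\dots,\zeta_n,\xi_n$ of points of the disjoint union such that $\zeta_1$ represents $p$, $\xi_n$ represents $q$, and $\xi_k\sim\zeta_{k+1}$ for $1\le k<n$. **Claim.** If $\mathbf r\in\ell^2$, i.e. $\sum_n r_n^2<\infty$, then $d_{\mathscr D}$ is a metric on $\mathscr D$ and $(\mathscr D,d_{\mathscr D})$ is Ahlfors $2$-regular: there is a constant $C\ge 1$ such that $\rho^2/C\le\mathcal H^2(B(p,\rho))\le C\rho^2$ for all $p\in\mathscr D$ and $0<\rho\le\operatorname{diam}\mathscr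 D$, where $B(p,\rho)$ is the open ball and $\mathcal H^2$ the Hausdorff $2$-measure. -/

import Mathlib

open Set Filter Topology
open scoped ENNReal

noncomputable section

namespace SlitCarpet

/-- The Euclidean plane. -/
abbrev Plane : Type := EuclideanSpace ℝ (Fin 2)

/-! ### General notions -/

/-- The path metric of a set `Ω` of the plane: the infimum of the lengths of the curves
in `Ω` from `x` to `y` (it is `⊤` if there is no rectifiable one). -/
def pathEDist (Ω : Set Plane) (x y : Plane) : ℝ≥0∞ :=
  ⨅ (γ : ℝ → Plane) (_ : ContinuousOn γ (Icc 0 1)) (_ : MapsTo γ (Icc 0 1) Ω)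
    (_ : γ 0 = x) (_ : γ 1 = y), eVariationOn γ (Icc 0 1)

/-- The quotient (chain) distance induced by a function `τ` on a quotient `Quotient S`:
the infimum of `∑ k ≤ n, τ (ζ k) (ξ k)` over all finite sequences
`ζ 0, ξ 0, …, ζ n, ξ n` such that `ζ 0 ∈ p`, `ξ n ∈ q` and `ξ k ∼ ζ (k + 1)` for `k < n`. -/
def chainEDist {X : Type*} (τ : X → X → ℝ≥0∞) (S : Setoid X) (p q : Quotient S) : ℝ≥0∞ :=
  ⨅ (n : ℕ) (ζ : ℕ → X) (ξ : ℕ → X) (_ : Quotient.mk S (ζ 0) = p)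
    (_ : Quotient.mk S (ξ n) = q) (_ : ∀ k < n, S (ξ k) (ζ (k + 1))),
    ∑ k ∈ Finset.range (n + 1), τ (ζ k) (ξ k)

/-- Ahlfors `Q`-regularity of a metric space, with respect to the Hausdorff `Q`-measure. -/
def IsAhlforsRegular (Q : ℝ) (X : Type*) [MetricSpace X] : Prop :=
  letI : MeasurableSpace X := borel X
  haveI : BorelSpace X := ⟨rfl⟩
  ∃ C : ℝ, 1 ≤ C ∧ ∀ (p : X) (ρ : ℝ), 0 < ρ →
    ENNReal.ofReal ρ ≤ Metric.ediam (univ : Set X) →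
      ENNReal.ofReal (ρ ^ Q / C) ≤ MeasureTheory.Measure.hausdorffMeasure Q (Metric.ball p ρ) ∧
      MeasureTheory.Measure.hausdorffMeasure Q (Metric.ball p ρ) ≤ ENNReal.ofReal (C * ρ ^ Q)

/-! ### Dyadic squares, slits and slit domains -/

/-- The dyadic square `[i/2ⁿ, (i+1)/2ⁿ] × [j/2ⁿ, (j+1)/2ⁿ]`, where `n = gen`. -/
structure DyadicSquare where
  gen : ℕ
  i : Fin (2 ^ gen)
  j : Fin (2 ^ gen)

namespace DyadicSquare

/-- First coordinate of the centre. -/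
def centerX (Δ : DyadicSquare) : ℝ := ((Δ.i : ℝ) + 1 / 2) / 2 ^ Δ.gen

/-- Second coordinate of the centre. -/
def centerY (Δ : DyadicSquare) : ℝ := ((Δ.j : ℝ) + 1 / 2) / 2 ^ Δ.gen

end DyadicSquare

variable (r : ℕ → Ioo (0 : ℝ) 1)

/-- The length of the slit of `Δ`. -/
def slitLength (Δ : DyadicSquare) : ℝ := (r Δ.gen : ℝ) / 2 ^ Δ.gen

/-- The second coordinate of the lower endpoint of the slit of `Δ`. -/
def slitBottom (Δ : DyadicSquare) : ℝ := Δ.centerY - slitLength r Δ / 2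

/-- The closed vertical slit of length `r_n 2⁻ⁿ` centred at the centre of `Δ`. -/
def slit (Δ : DyadicSquare) : Set Plane :=
  {z | z 0 = Δ.centerX ∧ z 1 ∈ Icc (slitBottom r Δ) (slitBottom r Δ + slitLength r Δ)}

/-- The slit domain `S_n`: the open unit square minus the slits of generation less than `n`. -/
def slitDomain (n : ℕ) : Set Plane :=
  {z | ∀ k, z k ∈ Ioo (0 : ℝ) 1} \ ⋃ (Δ : DyadicSquare) (_ : Δ.gen < n), slit r Δ

/-! ### The path metric is a finite distance on each slit domain -/

theorem pathEDist_le {Ω : Set Plane} {x y : Plane} {γ : ℝ → Plane}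
    (h1 : ContinuousOn γ (Icc 0 1)) (h2 : MapsTo γ (Icc 0 1) Ω) (h3 : γ 0 = x) (h4 : γ 1 = y) :
    pathEDist Ω x y ≤ eVariationOn γ (Icc 0 1) :=
  iInf_le_of_le γ <| iInf_le_of_le h1 <| iInf_le_of_le h2 <| iInf_le_of_le h3 <|
    iInf_le_of_le h4 le_rfl

theorem edist_le_pathEDist (Ω : Set Plane) (x y : Plane) : edist x y ≤ pathEDist Ω x y := by
  refine le_iInf fun γ => le_iInf fun _ => le_iInf fun _ => le_iInf fun h3 => le_iInf fun h4 => ?_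
  rw [← h3, ← h4]
  exact eVariationOn.edist_le γ (by simp) (by simp)

theorem pathEDist_mono {Ω Ω' : Set Plane} (h : Ω ⊆ Ω') (x y : Plane) :
    pathEDist Ω' x y ≤ pathEDist Ω x y :=
  le_iInf fun _ => le_iInf fun h1 => le_iInf fun h2 => le_iInf fun h3 => le_iInf fun h4 =>
    pathEDist_le h1 (h2.mono_right h) h3 h4

theorem pathEDist_self {Ω : Set Plane} {x : Plane} (hx : x ∈ Ω) : pathEDist Ω x x = 0 := by
  refine le_antisymm ?_ bot_le
  refine (pathEDist_le (γ := fun _ => x) continuousOn_const (fun _ _ => hx) rfl rfl).trans ?_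
  refine (eVariationOn.constant_on (f := fun _ : ℝ => x) ?_).le
  rintro _ ⟨_, _, rfl⟩ _ ⟨_, _, rfl⟩; rfl

theorem pathEDist_comm_le (Ω : Set Plane) (x y : Plane) : pathEDist Ω x y ≤ pathEDist Ω y x := by
  refine le_iInf fun γ => le_iInf fun h1 => le_iInf fun h2 => le_iInf fun h3 => le_iInf fun h4 => ?_
  have hm : MapsTo (fun t : ℝ => 1 - t) (Icc 0 1) (Icc 0 1) := fun t ht =>
    ⟨by linarith [ht.2], by linarith [ht.1]⟩
  refine (pathEDist_le (γ := fun t => γ (1 - t)) (h1.comp (by fun_prop) hm) (h2.comp hm)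
    (by simpa using h4) (by simpa using h3)).trans ?_
  exact eVariationOn.comp_le_of_antitoneOn γ (fun t : ℝ => 1 - t)
    (fun a _ b _ hab => by
      change 1 - b ≤ 1 - a
      linarith) hm

theorem pathEDist_triangle (Ω : Set Plane) (x y z : Plane) :
    pathEDist Ω x z ≤ pathEDist Ω x y + pathEDist Ω y z := by
  conv_rhs => unfold pathEDist
  simp only [ENNReal.iInf_add, ENNReal.add_iInf]
  refine le_iInf fun δ => le_iInf fun k1 => le_iInf fun k2 => le_iInf fun k3 => le_iInf fun k4 =>
    le_iInf fun γ => le_iInf fun h1 => le_iInf fun h2 => le_iInf fun h3 => le_iInf fun h4 => ?_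
  have ma : MapsTo (fun t : ℝ => 2 * t) (Icc 0 (1 / 2)) (Icc 0 1) := fun t ht =>
    ⟨by linarith [ht.1], by linarith [ht.2]⟩
  have mb : MapsTo (fun t : ℝ => 2 * t - 1) (Icc (1 / 2) 1) (Icc 0 1) := fun t ht =>
    ⟨by linarith [ht.1], by linarith [ht.2]⟩
  set η : ℝ → Plane := fun t => if t ≤ 1 / 2 then γ (2 * t) else δ (2 * t - 1) with hη
  have ea : EqOn η (γ ∘ fun t => 2 * t) (Icc 0 (1 / 2)) := fun t ht => by
    simp only [hη, Function.comp_apply, if_pos ht.2]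
  have eb : EqOn η (δ ∘ fun t => 2 * t - 1) (Icc (1 / 2) 1) := fun t ht => by
    rcases ht.1.eq_or_lt with h | h
    · subst h; simp [hη, h4, k3]
    · simp only [hη, Function.comp_apply, if_neg (not_le.2 h)]
  have hU : Icc (0 : ℝ) (1 / 2) ∪ Icc (1 / 2) 1 = Icc 0 1 :=
    Icc_union_Icc_eq_Icc (by norm_num) (by norm_num)
  have c : ContinuousOn η (Icc 0 1) := by
    rw [← hU]
    refine ContinuousOn.union_of_isClosed ?_ ?_ isClosed_Icc isClosed_Icc
    · exact (h1.comp (by fun_prop) ma).congr ea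
    · exact (k1.comp (by fun_prop) mb).congr eb
  have m : MapsTo η (Icc 0 1) Ω := by
    rw [← hU]
    refine MapsTo.union ?_ ?_
    · exact (h2.comp ma).congr ea.symm
    · exact (k2.comp mb).congr eb.symm
  refine (pathEDist_le c m (by simp [hη, h3]) (by norm_num [hη, k4])).trans ?_
  have := eVariationOn.Icc_add_Icc η (s := Icc 0 1) (a := 0) (b := 1 / 2) (c := 1)
    (by norm_num) (by norm_num) (by norm_num)
  have i1 : Icc (0 : ℝ) 1 ∩ Icc 0 (1 / 2) = Icc 0 (1 / 2) :=
    inter_eq_right.2 (Icc_subset_Icc_right (by norm_num))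
  have i2 : Icc (0 : ℝ) 1 ∩ Icc (1 / 2) 1 = Icc (1 / 2) 1 :=
    inter_eq_right.2 (Icc_subset_Icc_left (by norm_num))
  rw [inter_self, i1, i2] at this
  rw [← this, eVariationOn.congr ea, eVariationOn.congr eb]
  refine add_le_add ?_ ?_
  · refine eVariationOn.comp_le_of_monotoneOn γ (fun t : ℝ => 2 * t) (fun a _ b _ hab => ?_) ma
    change 2 * a ≤ 2 * b
    linarith
  · refine eVariationOn.comp_le_of_monotoneOn δ (fun t : ℝ => 2 * t - 1) (fun a _ b _ hab => ?_) mb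
    change 2 * a - 1 ≤ 2 * b - 1
    linarith

theorem pathEDist_ne_top_of_segment {Ω : Set Plane} {x y : Plane}
    (h : ∀ t ∈ Icc (0 : ℝ) 1, AffineMap.lineMap x y t ∈ Ω) : pathEDist Ω x y ≠ ⊤ := by
  have hl : LipschitzWith (nndist x y) (AffineMap.lineMap (k := ℝ) x y) := lipschitzWith_lineMap x y
  refine ne_top_of_le_ne_top ?_ (pathEDist_le (γ := AffineMap.lineMap x y)
    hl.continuous.continuousOn h (by simp) (by simp))
  have := hl.locallyBoundedVariationOn (Icc (0 : ℝ) 1) 0 1 (by simp) (by simp)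
  simpa [BoundedVariationOn] using this

theorem mem_slitDomain {n : ℕ} {z : Plane} : z ∈ slitDomain r n ↔
    (∀ k, z k ∈ Ioo (0 : ℝ) 1) ∧ ∀ Δ : DyadicSquare, Δ.gen < n → z ∉ slit r Δ := by
  simp [slitDomain]

theorem slitDomain_anti (n : ℕ) : slitDomain r (n + 1) ⊆ slitDomain r n := fun z hz => by
  rw [mem_slitDomain] at hz ⊢
  exact ⟨hz.1, fun Δ h => hz.2 Δ (by omega)⟩

/-- Some horizontal line misses all slits of generation less than `n`. -/
theorem exists_height (n : ℕ) : ∃ h ∈ Ioo (0 : ℝ) 1, ∀ x ∈ Ioo (0 : ℝ) 1,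
    !₂[x, h] ∈ slitDomain r n := by
  have : ∀ᶠ h : ℝ in 𝓝[>] 0, ∀ m ∈ Finset.range n, h < (1 - (r m : ℝ)) / 2 / 2 ^ m := by
    rw [Filter.eventually_all_finset]
    intro m _
    refine mem_nhdsWithin_of_mem_nhds (Iio_mem_nhds ?_)
    have := (r m).2.2
    have : 0 < 1 - (r m : ℝ) := by linarith
    positivity
  obtain ⟨h, h1, h2⟩ := (this.and (Ioo_mem_nhdsGT (zero_lt_one' ℝ))).exists
  refine ⟨h, h2, fun x hx => (mem_slitDomain r).2 ⟨fun k => ?_, fun Δ hΔ hs => ?_⟩⟩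
  · fin_cases k
    · simpa using hx
    · simpa using h2
  · have a := h1 Δ.gen (by simpa using hΔ)
    have b := hs.2.1
    simp only [slitBottom, slitLength, DyadicSquare.centerY, Matrix.cons_val_one,
      Matrix.cons_val_fin_one] at b
    have : ((Δ.j : ℝ) + 1 / 2) / 2 ^ Δ.gen - (r Δ.gen : ℝ) / 2 ^ Δ.gen / 2
        = (Δ.j : ℝ) / 2 ^ Δ.gen + (1 - (r Δ.gen : ℝ)) / 2 / 2 ^ Δ.gen := by ring
    have : 0 ≤ (Δ.j : ℝ) / 2 ^ Δ.gen := by positivity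
    linarith

/-- Every point can be moved a little to the right onto a vertical line without slits. -/
theorem exists_right (n : ℕ) (x : ℝ) (hx : x < 1) : ∃ x' ∈ Ioo x 1, ∀ u ∈ Ioc x x',
    ∀ Δ : DyadicSquare, Δ.gen < n → u ≠ Δ.centerX := by
  have : ∀ᶠ x' : ℝ in 𝓝[>] x, ∀ m ∈ Finset.range n, ∀ i ∈ Finset.range (2 ^ m),
      ¬ (((i : ℝ) + 1 / 2) / 2 ^ m ∈ Ioc x x') := by
    simp only [Filter.eventually_all_finset]
    intro m _ i _
    by_cases h : x < ((i : ℝ) + 1 / 2) / 2 ^ m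
    · filter_upwards [mem_nhdsWithin_of_mem_nhds (Iio_mem_nhds h)] with x' hx' hc
      exact absurd hc.2 (not_le.2 (mem_Iio.1 hx'))
    · exact Eventually.of_forall fun x' hc => h hc.1
  obtain ⟨x', h1, h2⟩ := (this.and (Ioo_mem_nhdsGT hx)).exists
  refine ⟨x', h2, fun u hu Δ hΔ he => h1 Δ.gen (by simpa using hΔ) Δ.i (by simp) ?_⟩
  rw [he] at hu
  exact ⟨hu.1, hu.2.trans' le_rfl⟩

theorem pathEDist_slitDomain_ne_top (n : ℕ) {z w : Plane} (hz : z ∈ slitDomain r n)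
    (hw : w ∈ slitDomain r n) : pathEDist (slitDomain r n) z w ≠ ⊤ := by
  obtain ⟨h, hh, H⟩ := exists_height r n
  have key : ∀ z ∈ slitDomain r n, ∃ x' ∈ Ioo (0 : ℝ) 1,
      pathEDist (slitDomain r n) z !₂[x', h] ≠ ⊤ := by
    intro z hz
    have hz' := (mem_slitDomain r).1 hz
    obtain ⟨x', hx', hu⟩ := exists_right n (z 0) (hz'.1 0).2
    have hx01 : x' ∈ Ioo (0 : ℝ) 1 := ⟨(hz'.1 0).1.trans hx'.1, hx'.2⟩
    refine ⟨x', hx01, ?_⟩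
    have conv : ∀ a b t : ℝ, a ∈ Ioo (0 : ℝ) 1 → b ∈ Ioo (0 : ℝ) 1 → t ∈ Icc (0 : ℝ) 1 →
        t * (b - a) + a ∈ Ioo (0 : ℝ) 1 := by
      intro a b t ha hb ht
      have := (convex_Ioo (0 : ℝ) 1) ha hb (sub_nonneg.2 ht.2) ht.1 (by ring)
      convert this using 1
      simp only [smul_eq_mul]; ring
    refine ne_top_of_le_ne_top (ENNReal.add_ne_top.2 ⟨?_, ?_⟩)
      (pathEDist_triangle _ z !₂[x', z 1] !₂[x', h])
    · refine pathEDist_ne_top_of_segment fun t ht => ?_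
      rcases ht.1.eq_or_lt with h0 | h0
      · simpa [← h0] using hz
      · refine (mem_slitDomain r).2 ⟨fun k => ?_, fun Δ hΔ hs => ?_⟩
        · fin_cases k
          · simpa [AffineMap.lineMap_apply] using conv _ _ t (hz'.1 0) hx01 ht
          · simpa [AffineMap.lineMap_apply] using hz'.1 1
        · refine hu _ ?_ Δ hΔ hs.1
          simp only [AffineMap.lineMap_apply, vsub_eq_sub, vadd_eq_add, PiLp.add_apply,
            PiLp.smul_apply, PiLp.sub_apply, Matrix.cons_val_zero, smul_eq_mul]
          constructor <;> nlinarith [hx'.1, ht.2]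
    · refine pathEDist_ne_top_of_segment fun t ht => ?_
      refine (mem_slitDomain r).2 ⟨fun k => ?_, fun Δ hΔ hs => ?_⟩
      · fin_cases k
        · simpa [AffineMap.lineMap_apply] using hx01
        · simpa [AffineMap.lineMap_apply] using conv _ _ t (hz'.1 1) hh ht
      · refine hu x' ⟨hx'.1, le_rfl⟩ Δ hΔ ?_
        simpa [AffineMap.lineMap_apply] using hs.1
  obtain ⟨x, hx, h1⟩ := key z hz
  obtain ⟨y, hy, h2⟩ := key w hw
  refine ne_top_of_le_ne_top (ENNReal.add_ne_top.2 ⟨h1, ENNReal.add_ne_top.2 ⟨?_,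
    ne_top_of_le_ne_top h2 (pathEDist_comm_le _ _ _)⟩⟩)
    ((pathEDist_triangle _ z !₂[x, h] w).trans (add_le_add le_rfl
      (pathEDist_triangle _ !₂[x, h] !₂[y, h] w)))
  refine pathEDist_ne_top_of_segment fun t ht => ?_
  convert H (AffineMap.lineMap x y t) ?_ using 1
  · ext k
    fin_cases k <;> simp [AffineMap.lineMap_apply]
  · have := (convex_Ioo (0 : ℝ) 1) hx hy (sub_nonneg.2 ht.2) ht.1 (by ring)
    convert this using 1
    simp only [AffineMap.lineMap_apply, smul_eq_mul, vsub_eq_sub, vadd_eq_add]; ring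

/-! ### The slit carpet -/

/-- The points of `S_n`, to be equipped with the path metric of `S_n`
(not with the Euclidean metric). -/
def SlitPoint (n : ℕ) : Type := {z : Plane // z ∈ slitDomain r n}

instance (n : ℕ) : PseudoEMetricSpace (SlitPoint r n) where
  edist z w := pathEDist (slitDomain r n) z.1 w.1
  edist_self z := pathEDist_self z.2
  edist_comm z w := le_antisymm (pathEDist_comm_le _ _ _) (pathEDist_comm_le _ _ _)
  edist_triangle z w v := pathEDist_triangle _ _ _ _

/-- `S_n` with its path metric. -/
instance (n : ℕ) : PseudoMetricSpace (SlitPoint r n) :=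
  PseudoEMetricSpace.toPseudoMetricSpace fun z w => pathEDist_slitDomain_ne_top r n z.2 w.2

/-- The completion `𝒮_n` of `S_n` in its path metric. -/
abbrev SlitSpace (n : ℕ) : Type := UniformSpace.Completion (SlitPoint r n)

/-- The inclusion of `S_{n+1}` in `S_n`. -/
def inclusion (n : ℕ) (z : SlitPoint r (n + 1)) : SlitPoint r n := ⟨z.1, slitDomain_anti r n z.2⟩

theorem lipschitzWith_inclusion (n : ℕ) : LipschitzWith 1 (inclusion r n) :=
  LipschitzWith.of_edist_le fun z w => pathEDist_mono (slitDomain_anti r n) z.1 w.1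

/-- The projection `𝒮_{n+1} → 𝒮_n`: the continuous extension of the inclusion. -/
def proj (n : ℕ) : SlitSpace r (n + 1) → SlitSpace r n := UniformSpace.Completion.map (inclusion r n)

/-- The slit carpet, as the inverse limit of the `𝒮_n`. -/
def Carpet : Type := {p : ∀ n, SlitSpace r n // ∀ n, proj r n (p (n + 1)) = p n}

/-- The metric `lim d_{𝒮_n}(p_n, q_n)` of the carpet. The sequence is nondecreasing
(see `tendsto_edist_carpet`), so the limit is the supremum. -/
instance : EMetricSpace (Carpet r) where
  edist p q := ⨆ n, edist (p.1 n) (q.1 n)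
  edist_self p := by simp
  edist_comm p q := by simp only [edist_comm]
  edist_triangle p q s := iSup_le fun n => (edist_triangle _ (q.1 n) _).trans
    (add_le_add (le_iSup (fun n => edist (p.1 n) (q.1 n)) n)
      (le_iSup (fun n => edist (q.1 n) (s.1 n)) n))
  eq_of_edist_eq_zero {p q} h := by
    refine Subtype.ext (funext fun n => edist_le_zero.1 ?_)
    exact (le_iSup (fun n => edist (p.1 n) (q.1 n)) n).trans (le_of_eq h)

theorem tendsto_edist_carpet (p q : Carpet r) :
    Tendsto (fun n => edist (p.1 n) (q.1 n)) atTop (𝓝 (edist p q)) := by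
  refine tendsto_atTop_iSup (monotone_nat_of_le_succ fun n => ?_)
  rw [← p.2 n, ← q.2 n]
  simpa [proj] using (lipschitzWith_inclusion r n).completion_map.edist_le_mul (p.1 (n + 1)) (q.1 (n + 1))

theorem lipschitzWith_val : LipschitzWith 1 (fun z : SlitPoint r 0 => z.1) :=
  LipschitzWith.of_edist_le fun z w => edist_le_pathEDist _ z.1 w.1

/-- The projection `π` of the carpet to the plane (with image in the closed unit square): the
projection to `𝒮_0`, followed by the continuous extension of the inclusion of `S_0 = (0,1)²`. -/
def toPlane (p : Carpet r) : Plane :=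
  UniformSpace.Completion.extension (fun z : SlitPoint r 0 => z.1) (p.1 0)

/-! ### The double of the carpet -/

/-- The boundary of the unit square. -/
def squareBoundary : Set Plane := {z | (∀ k, z k ∈ Icc (0 : ℝ) 1) ∧ ∃ k, z k = 0 ∨ z k = 1}

/-- Identification of two copies of the carpet along the outer square: points that project to the
same boundary point of the unit square are identified. -/
def doubleSetoid : Setoid (Bool × Carpet r) where
  r u v := u = v ∨ (toPlane r u.2 = toPlane r v.2 ∧ toPlane r u.2 ∈ squareBoundary)
  iseqv :=
    { refl := fun _ => Or.inl rfl
      symm := by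
        rintro u v (h | ⟨h, h'⟩)
        · exact Or.inl h.symm
        · exact Or.inr ⟨h.symm, h ▸ h'⟩
      trans := by
        rintro u v w (h | ⟨h, h'⟩) (k | ⟨k, k'⟩)
        · exact Or.inl (h.trans k)
        · exact Or.inr (h ▸ ⟨k, k'⟩)
        · exact Or.inr (k ▸ ⟨h, h'⟩)
        · exact Or.inr ⟨h.trans k, h'⟩ }

/-- The double of the carpet. -/
def Double : Type := Quotient (doubleSetoid r)

/-- The distance of the disjoint union of two copies of the carpet. -/
def copiesEDist (u v : Bool × Carpet r) : ℝ≥0∞ := if u.1 = v.1 then edist u.2 v.2 else ⊤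

/-- The quotient metric of the double. -/
def doubleEDist (p q : Double r) : ℝ≥0∞ := chainEDist (copiesEDist r) (doubleSetoid r) p q

/-! ### Pillowcases -/

/-- The rectangle `[-l, l] × [0, l]`, with the Euclidean metric. -/
abbrev Rect (l : ℝ) : Type := {z : Plane // z 0 ∈ Icc (-l) l ∧ z 1 ∈ Icc 0 l}

/-- The identifications `(x, 0) ∼ (-x, 0)` and `(x, l) ∼ (-x, l)`. -/
def pillowSetoid (l : ℝ) : Setoid (Rect l) where
  r z w := z = w ∨ (z.1 0 = -w.1 0 ∧ z.1 1 = w.1 1 ∧ (z.1 1 = 0 ∨ z.1 1 = l))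
  iseqv :=
    { refl := fun _ => Or.inl rfl
      symm := by
        rintro u v (h | ⟨h, h', h''⟩)
        · exact Or.inl h.symm
        · exact Or.inr ⟨by rw [h, neg_neg], h'.symm, h' ▸ h''⟩
      trans := by
        rintro u v w (h | ⟨h, h', h''⟩) (k | ⟨k, k', k''⟩)
        · exact Or.inl (h.trans k)
        · exact Or.inr (h ▸ ⟨k, k', k''⟩)
        · exact Or.inr (k ▸ ⟨h, h', h''⟩)
        · refine Or.inl (Subtype.ext (PiLp.ext fun a => ?_))
          fin_cases a
          · simpa [k] using h
          · exact h'.trans k' }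

/-- The square pillowcase of sidelength `l`. -/
def Pillow (l : ℝ) : Type := Quotient (pillowSetoid l)

/-- The quotient metric of the pillowcase. -/
def pillowEDist {l : ℝ} (p q : Pillow l) : ℝ≥0∞ :=
  chainEDist (fun z w : Rect l => edist z w) (pillowSetoid l) p q

/-! ### The glued surface -/

/-- The slits of the double: a copy of the carpet and a dyadic square. -/
abbrev SlitIndex : Type := Bool × DyadicSquare

/-- `p` is the point `p_z⁺`: it lies over `z`, on the right of the vertical line through `z`. -/
def IsRightLift (z : Plane) (p : Carpet r) : Prop :=
  toPlane r p = z ∧ p ∈ closure {q : Carpet r | z 0 < toPlane r q 0}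

/-- `p` is the point `p_z⁻`: it lies over `z`, on the left of the vertical line through `z`. -/
def IsLeftLift (z : Plane) (p : Carpet r) : Prop :=
  toPlane r p = z ∧ p ∈ closure {q : Carpet r | toPlane r q 0 < z 0}

/-- The graph of the gluing map of the slit `s` (with projection `{x} × [a, a + l]`), from the
boundary of the pillowcase of sidelength `l` to the slit: `[(l, t)]` is sent to `p_z⁺` and
`[(-l, t)]` to `p_z⁻`, where `z = (x, a + t)`. -/
def GluesTo (s : SlitIndex) (u : Pillow (slitLength r s.2)) (v : Double r) : Prop :=
  ∃ (c : Rect (slitLength r s.2)) (p : Carpet r),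
    u = Quotient.mk _ c ∧ v = Quotient.mk (doubleSetoid r) (s.1, p) ∧
      ((c.1 0 = slitLength r s.2 ∧ IsRightLift r !₂[s.2.centerX, slitBottom r s.2 + c.1 1] p) ∨
        (c.1 0 = -slitLength r s.2 ∧ IsLeftLift r !₂[s.2.centerX, slitBottom r s.2 + c.1 1] p))

/-- The disjoint union of the double and of one pillowcase for each of its slits. -/
abbrev Pieces : Type := Double r ⊕ (Σ s : SlitIndex, Pillow (slitLength r s.2))

/-- The equivalence relation generated by the gluing maps. -/
def glueSetoid : Setoid (Pieces r) :=
  Relation.EqvGen.setoid fun x y => ∃ (s : SlitIndex) (u : Pillow (slitLength r s.2))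
    (v : Double r), GluesTo r s u v ∧ x = Sum.inr ⟨s, u⟩ ∧ y = Sum.inl v

/-- The surface `𝒟`: the double with a pillowcase glued to each of its slits. -/
def Surface : Type := Quotient (glueSetoid r)

open Classical in
/-- The quasimetric `τ`. -/
def tau : Pieces r → Pieces r → ℝ≥0∞
  | Sum.inl p, Sum.inl q => doubleEDist r p q
  | Sum.inl p, Sum.inr ⟨s, q⟩ =>
      ⨅ (u : Pillow (slitLength r s.2)) (v : Double r) (_ : GluesTo r s u v),
        doubleEDist r p v + pillowEDist u q
  | Sum.inr ⟨s, p⟩, Sum.inl q =>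
      ⨅ (u : Pillow (slitLength r s.2)) (v : Double r) (_ : GluesTo r s u v),
        pillowEDist p u + doubleEDist r v q
  | Sum.inr ⟨s, p⟩, Sum.inr ⟨s', q⟩ =>
      if h : s = s' then pillowEDist p (h ▸ q)
      else
        ⨅ (u : Pillow (slitLength r s.2)) (v : Double r) (_ : GluesTo r s u v)
          (u' : Pillow (slitLength r s'.2)) (v' : Double r) (_ : GluesTo r s' u' v'),
          pillowEDist p u + doubleEDist r v v' + pillowEDist u' q

/-- The distance `d_𝒟`: the infimum of the sums `∑ τ(ζ_k, ξ_k)` over all chains. -/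
def surfaceEDist (p q : Surface r) : ℝ≥0∞ := chainEDist (tau r) (glueSetoid r) p q

end SlitCarpet

end

noncomputable section

namespace SlitCarpet

open UniformSpace (Completion)
open MeasureTheory MeasureTheory.Measure

/-! ### Chain distances -/

section Chain

variable {X : Type*} {τ : X → X → ℝ≥0∞} {S : Setoid X}

/-! A chain distance dominates `edist (f p) (f q)` for every `f` that respects the identifications
and is nonexpanding for the function defining the chains. Every lower bound on `d_𝒟` is therefore
obtained by exhibiting a `1`-Lipschitz function on the surface, assembled from compatible functions
on the carpets and the pillowcases (`exists_surface_lift`). Every upper bound comes from a one-step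
chain: the carpets and the rectangles of the pillowcases map `1`-Lipschitz into the surface.

Metric: four functions separate the points. They are the projection to the square, the distance to
the boundary of the square with a sign for the copy, the depth inside one pillowcase, and a tent
over a slit that takes opposite signs on its two sides. Whatever they fail to separate (outer
boundary, slit endpoints, folded edges) is identified in the surface.

Geometry of the carpet: the part over a dyadic square of generation `n` has diameter at most `5 / 2
^ n`, uniformly in the number of slits removed (`pathEDist_le_of_openSquare`). This gives
compactness, lifts of points, and covers at every scale.

Lower volume bound: a `1`-Lipschitz map to `ℝ × ℝ` does not increase `μH[2]`, which is Lebesgue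
measure there. A ball centred on a carpet contains the generic points over a dyadic square of
comparable size. A ball centred on a pillowcase contains a rectangle of comparable size if its
radius is at most a multiple of the side length, and otherwise a comparable ball centred on a
carpet.

Upper volume bound, for a ball of radius `ρ`: the carpet part is covered by about `(ρ 2ⁿ)²` pieces
of diameter about `2⁻ⁿ`. Slits of generation `g` with `2⁻ᵍ > ρ` that are relevant are at most `49`
per copy, and each of their pillowcases contributes `O(ρ²)`. For `2⁻ᵍ ≤ ρ` there are `O(ρ² 4ᵍ)`
relevant slits, each with a pillowcase of area `O(r_g² 4⁻ᵍ)`, so generation `g` contributes `O(ρ²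
r_g²)`. Summing over `g` is where `r ∈ ℓ²` enters. -/

theorem chainEDist_le_sum {p q : Quotient S} (n : ℕ) (ζ ξ : ℕ → X)
    (h0 : Quotient.mk S (ζ 0) = p) (h1 : Quotient.mk S (ξ n) = q)
    (h : ∀ k < n, S (ξ k) (ζ (k + 1))) :
    chainEDist τ S p q ≤ ∑ k ∈ Finset.range (n + 1), τ (ζ k) (ξ k) :=
  iInf_le_of_le n <| iInf_le_of_le ζ <| iInf_le_of_le ξ <| iInf_le_of_le h0 <|
    iInf_le_of_le h1 <| iInf_le_of_le h le_rfl

theorem chainEDist_mk_le (x y : X) :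
    chainEDist τ S (Quotient.mk S x) (Quotient.mk S y) ≤ τ x y := by
  simpa using chainEDist_le_sum (τ := τ) (S := S) 0 (fun _ => x) (fun _ => y) rfl rfl (by simp)

theorem chainEDist_self (h : ∀ x, τ x x = 0) (p : Quotient S) : chainEDist τ S p p = 0 := by
  induction p using Quotient.inductionOn with
  | h x => exact le_antisymm ((chainEDist_mk_le x x).trans (h x).le) bot_le

theorem chainEDist_comm_le (h : ∀ x y, τ x y = τ y x) (p q : Quotient S) :
    chainEDist τ S p q ≤ chainEDist τ S q p := by
  refine le_iInf fun n => le_iInf fun ζ => le_iInf fun ξ => le_iInf fun h0 => le_iInf fun h1 =>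
    le_iInf fun hS => ?_
  refine (chainEDist_le_sum n (fun k => ξ (n - k)) (fun k => ζ (n - k)) (by simpa using h1)
    (by simpa using h0) fun k hk => ?_).trans (le_of_eq ?_)
  · have := hS (n - (k + 1)) (by omega)
    rw [show n - (k + 1) + 1 = n - k by omega] at this
    exact S.symm this
  · rw [← Finset.sum_range_reflect]
    refine Finset.sum_congr rfl fun k hk => ?_
    have : k < n + 1 := by simpa using hk
    rw [h, show n - (n + 1 - 1 - k) = k by omega]

theorem chainEDist_triangle (p q s : Quotient S) :
    chainEDist τ S p s ≤ chainEDist τ S p q + chainEDist τ S q s := by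
  conv_rhs => unfold chainEDist
  simp only [ENNReal.iInf_add, ENNReal.add_iInf]
  refine le_iInf fun m => le_iInf fun ζ' => le_iInf fun ξ' => le_iInf fun k0 => le_iInf fun k1 =>
    le_iInf fun kS => le_iInf fun n => le_iInf fun ζ => le_iInf fun ξ => le_iInf fun h0 =>
    le_iInf fun h1 => le_iInf fun hS => ?_
  refine (chainEDist_le_sum (n + 1 + m) (fun k => if k < n + 1 then ζ k else ζ' (k - (n + 1)))
    (fun k => if k < n + 1 then ξ k else ξ' (k - (n + 1))) (by simpa using h0)
    (by simpa [show ¬ n + 1 + m ≤ n by omega] using k1) fun k hk => ?_).trans (le_of_eq ?_)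
  · rcases lt_trichotomy k n with h | rfl | h
    · simpa [h, h.trans (Nat.lt_succ_self n)] using hS k h
    -- At the junction of the two chains, both neighbouring points represent `q`.
    · simpa using Quotient.exact (h1.trans k0.symm)
    · have := kS (k - (n + 1)) (by omega)
      rw [show k - (n + 1) + 1 = k + 1 - (n + 1) by omega] at this
      simpa [show ¬ k < n + 1 by omega, show ¬ k < n by omega] using this
  · rw [show n + 1 + m + 1 = n + 1 + (m + 1) by ring, Finset.sum_range_add]
    congr 1
    · refine Finset.sum_congr rfl fun k hk => ?_
      rw [if_pos (by simpa using hk), if_pos (by simpa using hk)]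
    · simp [show ∀ x, ¬ n + 1 + x ≤ n by intro x; omega]

/-- The triangle inequality telescopes along a chain, because the jumps between equivalent points
are invisible to `f`. This is the only source of lower bounds for the chain distances. -/
theorem edist_le_chainEDist {Y : Type*} [PseudoEMetricSpace Y] (f : Quotient S → Y)
    (hf : ∀ x y, edist (f (Quotient.mk S x)) (f (Quotient.mk S y)) ≤ τ x y) (p q : Quotient S) :
    edist (f p) (f q) ≤ chainEDist τ S p q := by
  refine le_iInf fun n => le_iInf fun ζ => le_iInf fun ξ => le_iInf fun h0 => le_iInf fun h1 =>
    le_iInf fun hS => ?_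
  rw [← h0]
  clear h0
  induction n generalizing q with
  | zero => rw [← h1]; simpa using hf (ζ 0) (ξ 0)
  | succ n ih =>
    rw [Finset.sum_range_succ]
    refine (edist_triangle _ (f (Quotient.mk S (ξ n))) _).trans
      (add_le_add (ih _ rfl fun k hk => hS k (by omega)) ?_)
    rw [Quotient.sound (hS n (by omega)), ← h1]
    exact hf _ _

end Chain

variable (r : ℕ → Ioo (0 : ℝ) 1)

theorem slitLength_pos (Δ : DyadicSquare) : 0 < slitLength r Δ :=
  div_pos (r Δ.gen).2.1 (by positivity)

/-! ### The glued surface as a pseudometric space -/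

theorem copiesEDist_comm (u v : Bool × Carpet r) : copiesEDist r u v = copiesEDist r v u := by
  simp only [copiesEDist, eq_comm, edist_comm]

theorem doubleEDist_comm (p q : Double r) : doubleEDist r p q = doubleEDist r q p :=
  le_antisymm (chainEDist_comm_le (copiesEDist_comm r) p q)
    (chainEDist_comm_le (copiesEDist_comm r) q p)

theorem doubleEDist_self (p : Double r) : doubleEDist r p p = 0 :=
  chainEDist_self (fun u => by simp [copiesEDist]) p

theorem pillowEDist_comm {l : ℝ} (p q : Pillow l) : pillowEDist p q = pillowEDist q p :=
  le_antisymm (chainEDist_comm_le (fun _ _ => edist_comm _ _) p q)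
    (chainEDist_comm_le (fun _ _ => edist_comm _ _) q p)

theorem pillowEDist_self {l : ℝ} (p : Pillow l) : pillowEDist p p = 0 :=
  chainEDist_self (fun u => edist_self u) p

theorem tau_self (x : Pieces r) : tau r x x = 0 := by
  rcases x with p | ⟨s, p⟩
  · exact doubleEDist_self r p
  · simp [tau, pillowEDist_self]

theorem tau_comm_le (x y : Pieces r) : tau r x y ≤ tau r y x := by
  rcases x with p | ⟨s, p⟩ <;> rcases y with q | ⟨s', q⟩
  · exact (doubleEDist_comm r p q).le
  · simp only [tau]
    refine iInf_mono fun u => iInf_mono fun v => iInf_mono fun _ => ?_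
    rw [add_comm, doubleEDist_comm, pillowEDist_comm]
  · simp only [tau]
    refine iInf_mono fun u => iInf_mono fun v => iInf_mono fun _ => ?_
    rw [add_comm, doubleEDist_comm, pillowEDist_comm]
  · by_cases h : s = s'
    · subst h
      simp [tau, pillowEDist_comm]
    · have h' : ¬ s' = s := fun e => h e.symm
      simp only [tau, dif_neg h, dif_neg h']
      refine le_iInf fun u => le_iInf fun v => le_iInf fun hg => le_iInf fun u' => le_iInf fun v' =>
        le_iInf fun hg' => iInf_le_of_le u' <| iInf_le_of_le v' <| iInf_le_of_le hg' <|
        iInf_le_of_le u <| iInf_le_of_le v <| iInf_le_of_le hg ?_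
      rw [pillowEDist_comm p u', doubleEDist_comm r v' v, pillowEDist_comm u q]
      exact le_of_eq (by ring)

theorem tau_comm (x y : Pieces r) : tau r x y = tau r y x :=
  le_antisymm (tau_comm_le r x y) (tau_comm_le r y x)

theorem surfaceEDist_self (p : Surface r) : surfaceEDist r p p = 0 := chainEDist_self (tau_self r) p

theorem surfaceEDist_comm (p q : Surface r) : surfaceEDist r p q = surfaceEDist r q p :=
  le_antisymm (chainEDist_comm_le (tau_comm r) p q) (chainEDist_comm_le (tau_comm r) q p)

theorem surfaceEDist_triangle (p q s : Surface r) :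
    surfaceEDist r p s ≤ surfaceEDist r p q + surfaceEDist r q s := chainEDist_triangle p q s

/-- The point of the surface given by a point of a copy of the carpet. -/
def carpetPt (b : Bool) (p : Carpet r) : Surface r :=
  Quotient.mk (glueSetoid r) (Sum.inl (Quotient.mk (doubleSetoid r) (b, p)))

/-- The point of the surface given by a point of the rectangle defining a pillowcase. -/
def pillowPt (s : SlitIndex) (c : Rect (slitLength r s.2)) : Surface r :=
  Quotient.mk (glueSetoid r) (Sum.inr ⟨s, Quotient.mk _ c⟩)

theorem surface_cases {P : Surface r → Prop} (h1 : ∀ b p, P (carpetPt r b p))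
    (h2 : ∀ s c, P (pillowPt r s c)) (x : Surface r) : P x := by
  induction x using Quotient.inductionOn with
  | h x =>
    rcases x with p | ⟨s, p⟩
    · induction p using Quotient.inductionOn with
      | h p => exact h1 p.1 p.2
    · induction p using Quotient.inductionOn with
      | h c => exact h2 s c

theorem surfaceEDist_carpetPt_le (b : Bool) (p q : Carpet r) :
    surfaceEDist r (carpetPt r b p) (carpetPt r b q) ≤ edist p q := by
  refine (chainEDist_mk_le _ _).trans ((chainEDist_mk_le _ _).trans ?_)
  simp [copiesEDist]

theorem surfaceEDist_pillowPt_le (s : SlitIndex) (c c' : Rect (slitLength r s.2)) :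
    surfaceEDist r (pillowPt r s c) (pillowPt r s c') ≤ edist c c' := by
  refine (chainEDist_mk_le _ _).trans ?_
  simp only [tau, dif_pos]
  exact chainEDist_mk_le _ _

/-- The point of the slit `s` at height `t` above its lower endpoint. -/
def slitPt (Δ : DyadicSquare) (t : ℝ) : Plane := !₂[Δ.centerX, slitBottom r Δ + t]

theorem pillowPt_eq_of_right {s : SlitIndex} {c : Rect (slitLength r s.2)} {p : Carpet r}
    (hc : c.1 0 = slitLength r s.2) (hp : IsRightLift r (slitPt r s.2 (c.1 1)) p) :
    pillowPt r s c = carpetPt r s.1 p :=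
  Quotient.sound (s := glueSetoid r)
    (.rel _ _ ⟨s, _, _, ⟨c, p, rfl, rfl, Or.inl ⟨hc, hp⟩⟩, rfl, rfl⟩)

theorem pillowPt_eq_of_left {s : SlitIndex} {c : Rect (slitLength r s.2)} {p : Carpet r}
    (hc : c.1 0 = -slitLength r s.2) (hp : IsLeftLift r (slitPt r s.2 (c.1 1)) p) :
    pillowPt r s c = carpetPt r s.1 p :=
  Quotient.sound (s := glueSetoid r)
    (.rel _ _ ⟨s, _, _, ⟨c, p, rfl, rfl, Or.inr ⟨hc, hp⟩⟩, rfl, rfl⟩)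

theorem pillowPt_eq_of_fold {s : SlitIndex} {c c' : Rect (slitLength r s.2)}
    (h0 : c.1 0 = -c'.1 0) (h1 : c.1 1 = c'.1 1) (h : c.1 1 = 0 ∨ c.1 1 = slitLength r s.2) :
    pillowPt r s c = pillowPt r s c' := by
  unfold pillowPt
  congr 3
  exact Quotient.sound (s := pillowSetoid _) (Or.inr ⟨h0, h1, h⟩)

theorem carpetPt_eq_of_boundary {b b' : Bool} {p q : Carpet r}
    (h : toPlane r p = toPlane r q) (hb : toPlane r p ∈ squareBoundary) :
    carpetPt r b p = carpetPt r b' q := by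
  unfold carpetPt
  congr 2
  exact Quotient.sound (s := doubleSetoid r) (Or.inr ⟨h, hb⟩)

/-- Compatible `1`-Lipschitz functions on the two copies of the carpet and on the pillowcases
define a `1`-Lipschitz function on the surface. -/
theorem exists_surface_lift {Y : Type*} [PseudoEMetricSpace Y] (f : Bool → Carpet r → Y)
    (g : ∀ s : SlitIndex, Rect (slitLength r s.2) → Y)
    (hf : ∀ b, LipschitzWith 1 (f b)) (hg : ∀ s, LipschitzWith 1 (g s))
    (hdouble : ∀ b b' p q, toPlane r p = toPlane r q → toPlane r p ∈ squareBoundary →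
      f b p = f b' q)
    (hfold : ∀ s (c c' : Rect (slitLength r s.2)), c.1 0 = -c'.1 0 → c.1 1 = c'.1 1 →
      (c.1 1 = 0 ∨ c.1 1 = slitLength r s.2) → g s c = g s c')
    (hright : ∀ s (c : Rect (slitLength r s.2)) p, c.1 0 = slitLength r s.2 →
      IsRightLift r (slitPt r s.2 (c.1 1)) p → g s c = f s.1 p)
    (hleft : ∀ s (c : Rect (slitLength r s.2)) p, c.1 0 = -slitLength r s.2 →
      IsLeftLift r (slitPt r s.2 (c.1 1)) p → g s c = f s.1 p) :
    ∃ F : Surface r → Y, (∀ b p, F (carpetPt r b p) = f b p) ∧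
      (∀ s c, F (pillowPt r s c) = g s c) ∧ ∀ x y, edist (F x) (F y) ≤ surfaceEDist r x y := by
  let fD : Double r → Y := Quotient.lift (s := doubleSetoid r) (fun u => f u.1 u.2) (by
    rintro ⟨b, p⟩ ⟨b', q⟩ (h | ⟨h, h'⟩)
    · rw [h]
    · exact hdouble b b' p q h h')
  let gP : ∀ s : SlitIndex, Pillow (slitLength r s.2) → Y := fun s =>
    Quotient.lift (s := pillowSetoid (slitLength r s.2)) (g s) (by
      rintro c c' (h | ⟨h, h', h''⟩)
      · rw [h]
      · exact hfold s c c' h h' h'')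
  have hfD : ∀ p q, edist (fD p) (fD q) ≤ doubleEDist r p q := by
    refine edist_le_chainEDist fD ?_
    rintro ⟨b, p⟩ ⟨b', q⟩
    by_cases h : b = b'
    · subst h
      simpa [copiesEDist, fD] using hf b p q
    · simp [copiesEDist, h]
  have hgP : ∀ s p q, edist (gP s p) (gP s q) ≤ pillowEDist p q := fun s =>
    edist_le_chainEDist (gP s) fun c c' => by simpa [gP] using hg s c c'
  have hglue : ∀ s u v, GluesTo r s u v → gP s u = fD v := by
    rintro s u v ⟨c, p, rfl, rfl, ⟨hc, hp⟩ | ⟨hc, hp⟩⟩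
    · exact hright s c p hc hp
    · exact hleft s c p hc hp
  let h : Pieces r → Y := Sum.elim fD fun x => gP x.1 x.2
  have htau : ∀ x y, edist (h x) (h y) ≤ tau r x y := by
    rintro (p | ⟨s, p⟩) (q | ⟨s', q⟩)
    · exact hfD p q
    -- A passage through a slit splits at the glued point, where the two partial functions agree.
    · refine le_iInf fun u => le_iInf fun v => le_iInf fun k => ?_
      refine (edist_triangle _ (fD v) _).trans (add_le_add (hfD p v) ?_)
      rw [← hglue _ _ _ k]
      exact hgP s' u q
    · refine le_iInf fun u => le_iInf fun v => le_iInf fun k => ?_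
      refine (edist_triangle _ (fD v) _).trans (add_le_add ?_ (hfD v q))
      rw [← hglue _ _ _ k]
      exact hgP s p u
    · by_cases e : s = s'
      · subst e
        simpa [tau, h] using hgP s p q
      · simp only [tau, dif_neg e]
        refine le_iInf fun u => le_iInf fun v => le_iInf fun k => le_iInf fun u' => le_iInf fun v' =>
          le_iInf fun k' => ?_
        refine (edist_triangle4 _ (fD v) (fD v') _).trans
          (add_le_add (add_le_add ?_ (hfD v v')) ?_)
        · rw [← hglue _ _ _ k]
          exact hgP s p u
        · rw [← hglue _ _ _ k']
          exact hgP s' u' q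
  refine ⟨Quotient.lift (s := glueSetoid r) h ?_, fun b p => rfl, fun s c => rfl,
    edist_le_chainEDist _ htau⟩
  intro x y hxy
  induction hxy with
  | rel x y k =>
    obtain ⟨s, u, v, k, rfl, rfl⟩ := k
    exact hglue s u v k
  | refl => rfl
  | symm _ _ _ ih => exact ih.symm
  | trans _ _ _ _ _ ih ih' => exact ih.trans ih'

/-! ### Path metrics -/

theorem pathEDist_le_edist {Ω : Set Plane} {x y : Plane}
    (h : ∀ t ∈ Icc (0 : ℝ) 1, AffineMap.lineMap x y t ∈ Ω) : pathEDist Ω x y ≤ edist x y := by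
  have hl : LipschitzWith (nndist x y) (AffineMap.lineMap (k := ℝ) x y) := lipschitzWith_lineMap x y
  refine (pathEDist_le (γ := AffineMap.lineMap x y)
    hl.continuous.continuousOn h (by simp) (by simp)).trans ?_
  have h2 := (hl.lipschitzOnWith (s := univ)).comp_eVariationOn_le
    (g := fun t : ℝ => t) (s := Icc (0 : ℝ) 1) (fun _ _ => mem_univ _)
  refine h2.trans ?_
  have h3 := (monotone_id (α := ℝ)).monotoneOn (Icc (0 : ℝ) 1) |>.eVariationOn_eq
    (a := 0) (b := 1) (by simp) (by simp)
  rw [inter_self] at h3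
  change _ * eVariationOn id _ ≤ _
  rw [h3]
  simp

theorem pathEDist_le_edist_of_ball {Ω : Set Plane} {x y : Plane} {δ : ℝ}
    (h : Metric.ball x δ ⊆ Ω) (hy : dist y x < δ) : pathEDist Ω x y ≤ edist x y := by
  refine pathEDist_le_edist fun t ht => h ?_
  have hx : x ∈ Metric.ball x δ := Metric.mem_ball_self (dist_nonneg.trans_lt hy)
  have := (convex_ball x δ).segment_subset hx (Metric.mem_ball.2 hy)
  exact this (by rw [segment_eq_image_lineMap]; exact ⟨t, ht, rfl⟩)

theorem plane_eta (z : Plane) : !₂[z 0, z 1] = z := by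
  ext k; fin_cases k <;> rfl

theorem abs_coord_sub_le_dist (z w : Plane) (k : Fin 2) : |z k - w k| ≤ dist z w := by
  rw [dist_eq_norm]
  exact PiLp.norm_apply_le (z - w) k

theorem dist_le_abs_add_abs (z w : Plane) : dist z w ≤ |z 0 - w 0| + |z 1 - w 1| := by
  rw [EuclideanSpace.dist_eq, Fin.sum_univ_two, Real.dist_eq, Real.dist_eq]
  refine Real.sqrt_le_iff.2 ⟨by positivity, ?_⟩
  nlinarith [abs_nonneg (z 0 - w 0), abs_nonneg (z 1 - w 1)]

theorem pathEDist_horizontal {Ω : Set Plane} {x x' y : ℝ}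
    (h : ∀ u ∈ uIcc x x', !₂[u, y] ∈ Ω) :
    pathEDist Ω !₂[x, y] !₂[x', y] ≤ ENNReal.ofReal |x - x'| := by
  refine (pathEDist_le_edist fun t ht => ?_).trans ?_
  · have : AffineMap.lineMap x x' t ∈ uIcc x x' := by
      rw [← segment_eq_uIcc, segment_eq_image_lineMap]; exact ⟨t, ht, rfl⟩
    convert h _ this using 1
    ext k; fin_cases k <;> simp [AffineMap.lineMap_apply]
  · rw [edist_dist]
    exact ENNReal.ofReal_le_ofReal ((dist_le_abs_add_abs _ _).trans (by simp))

theorem pathEDist_vertical {Ω : Set Plane} {x y y' : ℝ}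
    (h : ∀ u ∈ uIcc y y', !₂[x, u] ∈ Ω) :
    pathEDist Ω !₂[x, y] !₂[x, y'] ≤ ENNReal.ofReal |y - y'| := by
  refine (pathEDist_le_edist fun t ht => ?_).trans ?_
  · have : AffineMap.lineMap y y' t ∈ uIcc y y' := by
      rw [← segment_eq_uIcc, segment_eq_image_lineMap]; exact ⟨t, ht, rfl⟩
    convert h _ this using 1
    ext k; fin_cases k <;> simp [AffineMap.lineMap_apply]
  · rw [edist_dist]
    exact ENNReal.ofReal_le_ofReal ((dist_le_abs_add_abs _ _).trans (by simp))

/-! ### Dyadic squares -/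

namespace DyadicSquare

/-- The open dyadic square. -/
def openSquare (Δ : DyadicSquare) : Set Plane :=
  {z | z 0 ∈ Ioo ((Δ.i : ℝ) / 2 ^ Δ.gen) (((Δ.i : ℝ) + 1) / 2 ^ Δ.gen) ∧
    z 1 ∈ Ioo ((Δ.j : ℝ) / 2 ^ Δ.gen) (((Δ.j : ℝ) + 1) / 2 ^ Δ.gen)}

theorem Ioo_subset {n : ℕ} (i : Fin (2 ^ n)) :
    Ioo ((i : ℝ) / 2 ^ n) (((i : ℝ) + 1) / 2 ^ n) ⊆ Ioo 0 1 := by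
  refine Ioo_subset_Ioo (by positivity) ?_
  rw [div_le_one (by positivity)]
  exact_mod_cast i.2

/-- The abscissa is an odd multiple of `2⁻⁽ᵍ⁺¹⁾`, `g` being the generation. Hence no vertical line
carrying a coarser slit meets the interior of a finer dyadic square. -/
theorem exists_centerX_eq (Δ : DyadicSquare) {n : ℕ} (h : Δ.gen < n) :
    ∃ K : ℕ, Δ.centerX = (K : ℝ) / 2 ^ n := by
  obtain ⟨m, rfl⟩ := Nat.exists_eq_add_of_lt h
  refine ⟨(2 * Δ.i + 1) * 2 ^ m, ?_⟩
  rw [centerX, div_eq_div_iff (by positivity) (by positivity)]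
  push_cast
  ring

theorem centerX_notMem_Ioo (Δ : DyadicSquare) {n : ℕ} (h : Δ.gen < n) (i : ℕ) :
    Δ.centerX ∉ Ioo ((i : ℝ) / 2 ^ n) (((i : ℝ) + 1) / 2 ^ n) := by
  obtain ⟨K, hK⟩ := Δ.exists_centerX_eq h
  rw [hK]
  rintro ⟨h1, h2⟩
  rw [div_lt_div_iff_of_pos_right (by positivity)] at h1 h2
  norm_cast at h1 h2
  omega

/-- If the generations differed, the coarser abscissa would lie in the interior of the finer column.
-/
theorem eq_of_centerX_eq {Δ Δ' : DyadicSquare} (h : Δ.centerX = Δ'.centerX) :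
    Δ.gen = Δ'.gen ∧ (Δ.i : ℕ) = Δ'.i := by
  have key : ∀ Δ Δ' : DyadicSquare, Δ.centerX = Δ'.centerX → ¬ Δ.gen < Δ'.gen := by
    intro Δ Δ' h hlt
    refine Δ.centerX_notMem_Ioo hlt Δ'.i ?_
    rw [h, centerX]
    constructor <;> gcongr <;> linarith
  have hg : Δ.gen = Δ'.gen := by
    have h1 := key Δ Δ' h
    have h2 := key Δ' Δ h.symm
    omega
  refine ⟨hg, ?_⟩
  simp only [centerX, hg] at h
  rw [div_left_inj' (by positivity)] at h
  have : (Δ.i : ℝ) = Δ'.i := by linarith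
  exact_mod_cast this

theorem ext_of_eq {Δ Δ' : DyadicSquare} (h : Δ.gen = Δ'.gen) (hi : (Δ.i : ℕ) = Δ'.i)
    (hj : (Δ.j : ℕ) = Δ'.j) : Δ = Δ' := by
  obtain ⟨n, i, j⟩ := Δ
  obtain ⟨n', i', j'⟩ := Δ'
  subst h
  congr 1
  · exact Fin.ext hi
  · exact Fin.ext hj

end DyadicSquare

/-- Since `r < 1`, a gap of `(1 - r) / 2 / 2 ^ gen` remains between the slit and the horizontal
sides of its square. -/
theorem slit_vertical {Δ : DyadicSquare} {z : Plane} (hz : z ∈ slit r Δ) :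
    z 1 ∈ Ioo ((Δ.j : ℝ) / 2 ^ Δ.gen) (((Δ.j : ℝ) + 1) / 2 ^ Δ.gen) := by
  obtain ⟨-, h1, h2⟩ := hz
  have hr := (r Δ.gen).2.2
  have e1 : slitBottom r Δ = (Δ.j : ℝ) / 2 ^ Δ.gen + (1 - r Δ.gen) / 2 / 2 ^ Δ.gen := by
    rw [slitBottom, slitLength, DyadicSquare.centerY]; ring
  have e2 : slitBottom r Δ + slitLength r Δ =
      ((Δ.j : ℝ) + 1) / 2 ^ Δ.gen - (1 - r Δ.gen) / 2 / 2 ^ Δ.gen := by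
    rw [slitBottom, slitLength, DyadicSquare.centerY]; ring
  have : 0 < (1 - (r Δ.gen : ℝ)) / 2 / 2 ^ Δ.gen := by
    have : 0 < 1 - (r Δ.gen : ℝ) := by linarith
    positivity
  constructor <;> linarith

theorem slit_subset_openSquare (Δ : DyadicSquare) : slit r Δ ⊆ Δ.openSquare := by
  intro z hz
  refine ⟨?_, slit_vertical r hz⟩
  rw [hz.1, DyadicSquare.centerX]
  constructor <;> gcongr <;> linarith

theorem slit_subset_unitSquare {Δ : DyadicSquare} {z : Plane} (hz : z ∈ slit r Δ) (k : Fin 2) :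
    z k ∈ Ioo (0 : ℝ) 1 := by
  have := slit_subset_openSquare r Δ hz
  fin_cases k
  · exact DyadicSquare.Ioo_subset _ this.1
  · exact DyadicSquare.Ioo_subset _ this.2

theorem eq_of_mem_slit {Δ Δ' : DyadicSquare} {z : Plane} (h : z ∈ slit r Δ) (h' : z ∈ slit r Δ') :
    Δ = Δ' := by
  obtain ⟨hg, hi⟩ := DyadicSquare.eq_of_centerX_eq (h.1.symm.trans h'.1)
  have h1 := slit_vertical r h
  have h2 := slit_vertical r h'
  refine DyadicSquare.ext_of_eq hg hi ?_
  simp only [← hg] at h2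
  have a := h1.1.trans h2.2
  have b := h2.1.trans h1.2
  rw [div_lt_div_iff_of_pos_right (by positivity)] at a b
  norm_cast at a b
  omega

theorem isClosed_slit (Δ : DyadicSquare) : IsClosed (slit r Δ) := by
  refine (isClosed_eq (by fun_prop) continuous_const).inter ?_
  exact isClosed_Icc.preimage (by fun_prop : Continuous fun z : Plane => z 1)

theorem isOpen_slitDomain (n : ℕ) : IsOpen (slitDomain r n) := by
  have h1 : IsOpen {z : Plane | ∀ k, z k ∈ Ioo (0 : ℝ) 1} := by
    simp only [Set.ofPred_forall]
    exact isOpen_iInter_of_finite fun k => isOpen_Ioo.preimage (by fun_prop : Continuous fun z : Plane => z k)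
  refine h1.sdiff ?_
  have hfin : {Δ : DyadicSquare | Δ.gen < n}.Finite := by
    refine (Set.finite_range fun x : (Σ m : Fin n, Fin (2 ^ (m : ℕ)) × Fin (2 ^ (m : ℕ))) =>
      (⟨x.1, x.2.1, x.2.2⟩ : DyadicSquare)).subset ?_
    rintro ⟨g, i, j⟩ h
    exact ⟨⟨⟨g, h⟩, i, j⟩, rfl⟩
  exact hfin.isClosed_biUnion fun Δ _ => isClosed_slit r Δ

/-- Some horizontal line of an open dyadic square misses all slits of generation less than `m`. -/
theorem exists_height_openSquare (Δ : DyadicSquare) (m : ℕ) :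
    ∃ h ∈ Ioo ((Δ.j : ℝ) / 2 ^ Δ.gen) (((Δ.j : ℝ) + 1) / 2 ^ Δ.gen),
      ∀ x ∈ Ioo ((Δ.i : ℝ) / 2 ^ Δ.gen) (((Δ.i : ℝ) + 1) / 2 ^ Δ.gen),
        !₂[x, h] ∈ slitDomain r m := by
  -- The line runs just above the bottom side of `Δ`, inside the gap that each of the finitely many
  -- generations leaves along the horizontal sides of its squares.
  have : ∀ᶠ h : ℝ in 𝓝[>] 0, ∀ g ∈ Finset.range m, h < (1 - (r g : ℝ)) / 2 / 2 ^ g := by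
    rw [Filter.eventually_all_finset]
    intro g _
    refine mem_nhdsWithin_of_mem_nhds (Iio_mem_nhds ?_)
    have := (r g).2.2
    have : 0 < 1 - (r g : ℝ) := by linarith
    positivity
  obtain ⟨h, h1, h2⟩ := (this.and (Ioo_mem_nhdsGT
    (show (0 : ℝ) < 1 / 2 ^ Δ.gen by positivity))).exists
  have hh : (Δ.j : ℝ) / 2 ^ Δ.gen + h ∈
      Ioo ((Δ.j : ℝ) / 2 ^ Δ.gen) (((Δ.j : ℝ) + 1) / 2 ^ Δ.gen) := by
    rw [add_div]
    exact ⟨by linarith [h2.1], by linarith [h2.2]⟩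
  refine ⟨_, hh, fun x hx => (mem_slitDomain r).2 ⟨fun k => ?_, fun Δ' hΔ' hs => ?_⟩⟩
  · fin_cases k
    · exact DyadicSquare.Ioo_subset _ hx
    · exact DyadicSquare.Ioo_subset _ hh
  · have hx' : x = Δ'.centerX := by simpa using hs.1
    rcases lt_or_ge Δ'.gen Δ.gen with hlt | hge
    · exact Δ'.centerX_notMem_Ioo hlt Δ.i (hx' ▸ hx)
    · obtain ⟨a, ha⟩ := Nat.exists_eq_add_of_le hge
      have hs2 := hs.2
      simp only [Matrix.cons_val_one, Matrix.cons_val_fin_one, mem_Icc] at hs2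
      have e1 : slitBottom r Δ' = (Δ'.j : ℝ) / 2 ^ Δ'.gen + (1 - r Δ'.gen) / 2 / 2 ^ Δ'.gen := by
        rw [slitBottom, slitLength, DyadicSquare.centerY]; ring
      have e2 : slitBottom r Δ' + slitLength r Δ' =
          ((Δ'.j : ℝ) + 1) / 2 ^ Δ'.gen - (1 - r Δ'.gen) / 2 / 2 ^ Δ'.gen := by
        rw [slitBottom, slitLength, DyadicSquare.centerY]; ring
      rw [e2, e1] at hs2
      have hlt := h1 Δ'.gen (by simpa using hΔ')
      -- The bottom side of `Δ` is also a horizontal dyadic line of the finer generation, so the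
      -- slit of `Δ'` keeps its gap from it.
      have e3 : (Δ.j : ℝ) / 2 ^ Δ.gen = ((Δ.j * 2 ^ a : ℕ) : ℝ) / 2 ^ Δ'.gen := by
        rw [ha, div_eq_div_iff (by positivity) (by positivity)]
        push_cast
        ring
      rw [e3] at hs2
      have : 0 < (1 - (r Δ'.gen : ℝ)) / 2 / 2 ^ Δ'.gen := h2.1.trans hlt
      have a1 : (Δ'.j : ℝ) / 2 ^ Δ'.gen < ((Δ.j * 2 ^ a : ℕ) : ℝ) / 2 ^ Δ'.gen := by linarith [hs2.1]
      have a2 : ((Δ.j * 2 ^ a : ℕ) : ℝ) / 2 ^ Δ'.gen < ((Δ'.j : ℝ) + 1) / 2 ^ Δ'.gen := by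
        linarith [hs2.2, h2.1]
      rw [div_lt_div_iff_of_pos_right (by positivity)] at a1 a2
      norm_cast at a1 a2
      omega

theorem abs_sub_le_of_mem_Ioo {a b x y : ℝ} (hx : x ∈ Ioo a b) (hy : y ∈ Ioo a b) :
    |x - y| ≤ b - a := by
  rw [abs_le]
  constructor <;> linarith [hx.1, hx.2, hy.1, hy.2]

/-- The part of a slit domain in an open dyadic square of generation `n` has path diameter at most
`5 / 2 ^ n`. -/
theorem pathEDist_le_of_openSquare (Δ : DyadicSquare) (m : ℕ) {z w : Plane}
    (hz : z ∈ slitDomain r m) (hz' : z ∈ Δ.openSquare) (hw : w ∈ slitDomain r m)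
    (hw' : w ∈ Δ.openSquare) :
    pathEDist (slitDomain r m) z w ≤ ENNReal.ofReal (5 / 2 ^ Δ.gen) := by
  set Ix := Ioo ((Δ.i : ℝ) / 2 ^ Δ.gen) (((Δ.i : ℝ) + 1) / 2 ^ Δ.gen) with hIx
  set Iy := Ioo ((Δ.j : ℝ) / 2 ^ Δ.gen) (((Δ.j : ℝ) + 1) / 2 ^ Δ.gen) with hIy
  obtain ⟨h, hh, H⟩ := exists_height_openSquare r Δ m
  have dx : ∀ x ∈ Ix, ∀ y ∈ Ix, |x - y| ≤ 1 / 2 ^ Δ.gen := fun x hx y hy =>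
    (abs_sub_le_of_mem_Ioo hx hy).trans (by ring_nf; exact le_rfl)
  have dy : ∀ x ∈ Iy, ∀ y ∈ Iy, |x - y| ≤ 1 / 2 ^ Δ.gen := fun x hx y hy =>
    (abs_sub_le_of_mem_Ioo hx hy).trans (by ring_nf; exact le_rfl)
  -- A small move to the right reaches a vertical line free of slits, which leads to the free
  -- horizontal line. The constant is `5 = 2 + 1 + 2` sides: two for each endpoint and one along the
  -- horizontal line.
  have key : ∀ z ∈ slitDomain r m, z ∈ Δ.openSquare → ∃ x' ∈ Ix,
      pathEDist (slitDomain r m) z !₂[x', h] ≤ ENNReal.ofReal (2 / 2 ^ Δ.gen) := by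
    intro z hz hz'
    obtain ⟨x₁, hx₁, hu⟩ := exists_right m (z 0) (((mem_slitDomain r).1 hz).1 0).2
    obtain ⟨x', ha, hb⟩ := exists_between (lt_min hx₁.1 hz'.1.2)
    have hx' : x' ∈ Ix := ⟨hz'.1.1.trans ha, hb.trans_le (min_le_right _ _)⟩
    have hfree : ∀ u ∈ Ioc (z 0) x', ∀ Δ' : DyadicSquare, Δ'.gen < m → u ≠ Δ'.centerX :=
      fun u hu' => hu u ⟨hu'.1, hu'.2.trans (hb.le.trans (min_le_left _ _))⟩
    refine ⟨x', hx', (pathEDist_triangle _ z !₂[x', z 1] _).trans ?_⟩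
    have e : ENNReal.ofReal (2 / 2 ^ Δ.gen) =
        ENNReal.ofReal (1 / 2 ^ Δ.gen) + ENNReal.ofReal (1 / 2 ^ Δ.gen) := by
      rw [← ENNReal.ofReal_add (by positivity) (by positivity)]; ring_nf
    rw [e]
    refine add_le_add ?_ ?_
    · conv_lhs => rw [← plane_eta z]
      refine (pathEDist_horizontal fun u hu => ?_).trans
        (ENNReal.ofReal_le_ofReal (dx _ hz'.1 _ hx'))
      rw [uIcc_of_le ha.le] at hu
      rcases hu.1.eq_or_lt with h0 | h0
      · rw [← h0, plane_eta]; exact hz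
      · refine (mem_slitDomain r).2 ⟨fun k => ?_, fun Δ' hΔ' hs => ?_⟩
        · fin_cases k
          · exact DyadicSquare.Ioo_subset Δ.i ⟨hz'.1.1.trans h0, hu.2.trans_lt hx'.2⟩
          · exact DyadicSquare.Ioo_subset _ hz'.2
        · exact hfree u ⟨h0, hu.2⟩ Δ' hΔ' (by simpa using hs.1)
    · refine (pathEDist_vertical fun u hu => ?_).trans
        (ENNReal.ofReal_le_ofReal (dy _ hz'.2 _ hh))
      have hu' : u ∈ Iy := ordConnected_Ioo.uIcc_subset hz'.2 hh hu
      refine (mem_slitDomain r).2 ⟨fun k => ?_, fun Δ' hΔ' hs => ?_⟩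
      · fin_cases k
        · exact DyadicSquare.Ioo_subset _ hx'
        · exact DyadicSquare.Ioo_subset _ hu'
      · exact hfree x' ⟨ha, le_rfl⟩ Δ' hΔ' (by simpa using hs.1)
  obtain ⟨x, hx, h1⟩ := key z hz hz'
  obtain ⟨y, hy, h2⟩ := key w hw hw'
  have h3 : pathEDist (slitDomain r m) !₂[x, h] !₂[y, h] ≤ ENNReal.ofReal (1 / 2 ^ Δ.gen) :=
    (pathEDist_horizontal fun u hu => H u (ordConnected_Ioo.uIcc_subset hx hy hu)).trans
      (ENNReal.ofReal_le_ofReal (dx _ hx _ hy))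
  refine (pathEDist_triangle _ z !₂[x, h] w).trans ((add_le_add h1
    ((pathEDist_triangle _ _ !₂[y, h] w).trans (add_le_add h3
      ((pathEDist_comm_le _ _ _).trans h2)))).trans (le_of_eq ?_))
  rw [← ENNReal.ofReal_add (by positivity) (by positivity),
    ← ENNReal.ofReal_add (by positivity) (by positivity)]
  congr 1
  ring

/-! ### Projections to the plane -/

theorem lipschitzWith_slitPoint_val (n : ℕ) : LipschitzWith 1 (fun z : SlitPoint r n => z.1) :=
  LipschitzWith.of_edist_le fun z w => edist_le_pathEDist _ z.1 w.1

/-- The projection of the completed slit domain to the plane. -/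
def planeProj (n : ℕ) : SlitSpace r n → Plane := Completion.extension fun z : SlitPoint r n => z.1

theorem lipschitzWith_planeProj (n : ℕ) : LipschitzWith 1 (planeProj r n) :=
  (lipschitzWith_slitPoint_val r n).completion_extension

theorem planeProj_coe {n : ℕ} (z : SlitPoint r n) : planeProj r n z = z.1 :=
  Completion.extension_coe (lipschitzWith_slitPoint_val r n).uniformContinuous z

theorem lipschitzWith_proj (n : ℕ) : LipschitzWith 1 (proj r n) :=
  (lipschitzWith_inclusion r n).completion_map

theorem proj_coe {n : ℕ} (z : SlitPoint r (n + 1)) :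
    proj r n z = (inclusion r n z : SlitSpace r n) :=
  Completion.map_coe (lipschitzWith_inclusion r n).uniformContinuous z

theorem planeProj_proj (n : ℕ) (a : SlitSpace r (n + 1)) :
    planeProj r n (proj r n a) = planeProj r (n + 1) a := by
  induction a using Completion.induction_on with
  | hp =>
    exact isClosed_eq
      ((lipschitzWith_planeProj r n).continuous.comp (lipschitzWith_proj r n).continuous)
      (lipschitzWith_planeProj r (n + 1)).continuous
  | ih z => rw [proj_coe, planeProj_coe, planeProj_coe]; rfl

theorem toPlane_eq (p : Carpet r) (n : ℕ) : toPlane r p = planeProj r n (p.1 n) := by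
  induction n with
  | zero => rfl
  | succ n ih => rw [ih, ← p.2 n, planeProj_proj]

theorem lipschitzWith_carpet_eval (n : ℕ) : LipschitzWith 1 (fun p : Carpet r => p.1 n) :=
  LipschitzWith.of_edist_le fun p q => le_iSup (fun n => edist (p.1 n) (q.1 n)) n

theorem lipschitzWith_toPlane : LipschitzWith 1 (toPlane r) := by
  rw [← one_mul (1 : NNReal)]
  exact (lipschitzWith_planeProj r 0).comp (lipschitzWith_carpet_eval r 0)

theorem continuous_toPlane : Continuous (toPlane r) := (lipschitzWith_toPlane r).continuous

theorem continuous_coord (k : Fin 2) : Continuous fun z : Plane => z k := by fun_prop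

theorem planeProj_mem_Icc {n : ℕ} (a : SlitSpace r n) (k : Fin 2) :
    planeProj r n a k ∈ Icc (0 : ℝ) 1 := by
  induction a using Completion.induction_on with
  | hp =>
    exact isClosed_Icc.preimage
      ((continuous_coord k).comp (lipschitzWith_planeProj r n).continuous)
  | ih z => rw [planeProj_coe]; exact Ioo_subset_Icc_self (((mem_slitDomain r).1 z.2).1 k)

theorem toPlane_mem_Icc (p : Carpet r) (k : Fin 2) : toPlane r p k ∈ Icc (0 : ℝ) 1 :=
  planeProj_mem_Icc r _ k

/-- A point of the slit domain, as a point of its completion. -/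
def ofMem {n : ℕ} {z : Plane} (hz : z ∈ slitDomain r n) : SlitSpace r n :=
  Completion.coe' (⟨z, hz⟩ : SlitPoint r n)

theorem planeProj_ofMem {n : ℕ} {z : Plane} (hz : z ∈ slitDomain r n) :
    planeProj r n (ofMem r hz) = z :=
  planeProj_coe r _

theorem proj_ofMem {n : ℕ} {z : Plane} (hz : z ∈ slitDomain r (n + 1)) :
    proj r n (ofMem r hz) = ofMem r (slitDomain_anti r n hz) :=
  proj_coe r _

theorem edist_slitPoint {n : ℕ} (z w : SlitPoint r n) :
    edist (z : SlitSpace r n) (w : SlitSpace r n) = pathEDist (slitDomain r n) z.1 w.1 :=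
  Completion.edist_eq z w

/-! ### Generic points -/

/-- The open unit square. -/
def unitSquare : Set Plane := {z | ∀ k, z k ∈ Ioo (0 : ℝ) 1}

theorem isOpen_unitSquare : IsOpen unitSquare := by
  simp only [unitSquare, Set.ofPred_forall]
  exact isOpen_iInter_of_finite fun k => isOpen_Ioo.preimage (continuous_coord k)

/-- The points of the open unit square with irrational coordinates. -/
def genericSet : Set Plane := {z | z ∈ unitSquare ∧ ∀ k, Irrational (z k)}

theorem genericSet_subset_slitDomain (n : ℕ) : genericSet ⊆ slitDomain r n := by
  refine fun z hz => (mem_slitDomain r).2 ⟨hz.1, fun Δ _ h => hz.2 0 ?_⟩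
  rw [h.1]
  exact ⟨(Δ.i + 1 / 2) / 2 ^ Δ.gen, by push_cast; rfl⟩

/-- Irrational coordinates avoid all dyadic lines, so the floor of `z k * 2 ^ n` gives strict
inequalities. -/
theorem exists_mem_openSquare {z : Plane} (hz : z ∈ genericSet) (n : ℕ) :
    ∃ i j : Fin (2 ^ n), z ∈ (DyadicSquare.mk n i j).openSquare := by
  have key : ∀ k, ∃ i : Fin (2 ^ n), z k ∈ Ioo ((i : ℝ) / 2 ^ n) (((i : ℝ) + 1) / 2 ^ n) := by
    intro k
    have hp : (0 : ℝ) < 2 ^ n := by positivity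
    have h0 : 0 ≤ z k * 2 ^ n := mul_nonneg (hz.1 k).1.le hp.le
    refine ⟨⟨⌊z k * 2 ^ n⌋₊, ?_⟩, ?_, ?_⟩
    · rw [Nat.floor_lt h0]
      push_cast
      nlinarith [(hz.1 k).2]
    · refine lt_of_le_of_ne ((div_le_iff₀ hp).2 (Nat.floor_le h0)) fun h => hz.2 k ?_
      rw [← h]
      exact ⟨(⌊z k * 2 ^ n⌋₊ : ℚ) / 2 ^ n, by push_cast; rfl⟩
    · rw [lt_div_iff₀ hp]
      exact Nat.lt_floor_add_one _
  obtain ⟨i, hi⟩ := key 0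
  obtain ⟨j, hj⟩ := key 1
  exact ⟨i, j, hi, hj⟩

theorem exists_generic {U : Set Plane} (hU : IsOpen U) (h : (U ∩ unitSquare).Nonempty) :
    ∃ z ∈ U, z ∈ genericSet := by
  have hd : Dense {z : Plane | ∀ k, Irrational (z k)} := by
    have h1 : Dense (univ.pi fun _ : Fin 2 => {x : ℝ | Irrational x}) :=
      dense_pi univ fun _ _ => dense_irrational
    have h2 := h1.preimage (EuclideanSpace.equiv (Fin 2) ℝ).toHomeomorph.isOpenMap
    exact h2.mono fun z (hz : _ ∈ univ.pi _) k => hz k (mem_univ k)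
  obtain ⟨z, hz, hz'⟩ := hd.inter_open_nonempty _ (hU.inter isOpen_unitSquare) h
  exact ⟨z, hz.1, hz.2, hz'⟩

theorem exists_generic_openSquare (Δ : DyadicSquare) : ∃ z ∈ Δ.openSquare, z ∈ genericSet := by
  have ho : IsOpen Δ.openSquare :=
    (isOpen_Ioo.preimage (continuous_coord 0)).inter (isOpen_Ioo.preimage (continuous_coord 1))
  obtain ⟨x, hx⟩ := nonempty_Ioo.2 (show (Δ.i : ℝ) / 2 ^ Δ.gen < (Δ.i + 1) / 2 ^ Δ.gen by
    gcongr; linarith)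
  obtain ⟨y, hy⟩ := nonempty_Ioo.2 (show (Δ.j : ℝ) / 2 ^ Δ.gen < (Δ.j + 1) / 2 ^ Δ.gen by
    gcongr; linarith)
  refine exists_generic ho ⟨!₂[x, y], ⟨hx, hy⟩, fun k => ?_⟩
  fin_cases k
  · exact DyadicSquare.Ioo_subset _ hx
  · exact DyadicSquare.Ioo_subset _ hy

/-- The point of the carpet over a generic point. -/
def genericPt (z : Plane) (hz : z ∈ genericSet) : Carpet r :=
  ⟨fun n => ofMem r (genericSet_subset_slitDomain r n hz), fun _ => proj_ofMem r _⟩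

theorem toPlane_genericPt (z : Plane) (hz : z ∈ genericSet) : toPlane r (genericPt r z hz) = z :=
  planeProj_ofMem r _

/-! ### Pieces of the carpet over dyadic squares -/

/-- The points of a completed slit domain over an open dyadic square. -/
def squarePts (Δ : DyadicSquare) (m : ℕ) : Set (SlitSpace r m) :=
  (fun z : SlitPoint r m => (z : SlitSpace r m)) '' {z | z.1 ∈ Δ.openSquare}

/-- The part of the carpet over a dyadic square. -/
def squareCarpet (Δ : DyadicSquare) : Set (Carpet r) := {p | ∀ m, p.1 m ∈ closure (squarePts r Δ m)}

theorem ediam_squarePts_le (Δ : DyadicSquare) (m : ℕ) :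
    Metric.ediam (squarePts r Δ m) ≤ ENNReal.ofReal (5 / 2 ^ Δ.gen) := by
  refine Metric.ediam_le ?_
  rintro _ ⟨z, hz, rfl⟩ _ ⟨w, hw, rfl⟩
  rw [edist_slitPoint]
  exact pathEDist_le_of_openSquare r Δ m z.2 hz w.2 hw

theorem ediam_squareCarpet_le (Δ : DyadicSquare) :
    Metric.ediam (squareCarpet r Δ) ≤ ENNReal.ofReal (5 / 2 ^ Δ.gen) := by
  refine Metric.ediam_le fun p hp q hq => iSup_le fun m => ?_
  refine (Metric.edist_le_ediam_of_mem (hp m) (hq m)).trans ?_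
  rw [Metric.ediam_closure]
  exact ediam_squarePts_le r Δ m

theorem genericPt_mem_squareCarpet {z : Plane} (hz : z ∈ genericSet) {Δ : DyadicSquare}
    (h : z ∈ Δ.openSquare) : genericPt r z hz ∈ squareCarpet r Δ :=
  fun m => subset_closure ⟨⟨z, genericSet_subset_slitDomain r m hz⟩, h, rfl⟩

theorem toPlane_of_mem_squareCarpet {Δ : DyadicSquare} {p : Carpet r} (hp : p ∈ squareCarpet r Δ) :
    toPlane r p 0 ∈ Icc ((Δ.i : ℝ) / 2 ^ Δ.gen) (((Δ.i : ℝ) + 1) / 2 ^ Δ.gen) ∧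
      toPlane r p 1 ∈ Icc ((Δ.j : ℝ) / 2 ^ Δ.gen) (((Δ.j : ℝ) + 1) / 2 ^ Δ.gen) := by
  have hc := (lipschitzWith_planeProj r 0).continuous
  have : closure (squarePts r Δ 0) ⊆ planeProj r 0 ⁻¹'
      {z | z 0 ∈ Icc ((Δ.i : ℝ) / 2 ^ Δ.gen) (((Δ.i : ℝ) + 1) / 2 ^ Δ.gen) ∧
        z 1 ∈ Icc ((Δ.j : ℝ) / 2 ^ Δ.gen) (((Δ.j : ℝ) + 1) / 2 ^ Δ.gen)} := by
    refine closure_minimal ?_ (((isClosed_Icc.preimage (continuous_coord 0)).inter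
      (isClosed_Icc.preimage (continuous_coord 1))).preimage hc)
    rintro _ ⟨z, hz, rfl⟩
    rw [mem_preimage, planeProj_coe]
    exact ⟨Ioo_subset_Icc_self hz.1, Ioo_subset_Icc_self hz.2⟩
  exact this (hp 0)

/-- Generic points are dense in `S_n` for the path metric, which is bounded by the Euclidean one on
small balls of this open set. The union over squares is finite, so it commutes with closure. -/
theorem exists_mem_closure_squarePts (n m : ℕ) (a : SlitSpace r m) :
    ∃ x : Fin (2 ^ n) × Fin (2 ^ n), a ∈ closure (squarePts r ⟨n, x.1, x.2⟩ m) := by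
  rw [← mem_iUnion, ← closure_iUnion_of_finite]
  induction a using Completion.induction_on with
  | hp =>
    exact isClosed_closure
      | ih z =>
    refine EMetric.mem_closure_iff.2 fun ε hε => ?_
    obtain ⟨δ, hδ, hb⟩ := Metric.isOpen_iff.1 (isOpen_slitDomain r m) z.1 z.2
    obtain ⟨ε', hε', hε''⟩ := ENNReal.lt_iff_exists_real_btwn.1 hε
    have hε0 : 0 < ε' := by simpa using hε''.1
    obtain ⟨w, hw, hg⟩ := exists_generic (Metric.isOpen_ball (x := z.1) (ε := min δ ε'))
      ⟨z.1, Metric.mem_ball_self (lt_min hδ hε0), ((mem_slitDomain r).1 z.2).1⟩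
    obtain ⟨i, j, hij⟩ := exists_mem_openSquare hg n
    refine ⟨_, mem_iUnion.2 ⟨(i, j), ⟨⟨w, genericSet_subset_slitDomain r m hg⟩, hij, rfl⟩⟩, ?_⟩
    refine (edist_slitPoint r _ _).trans_lt ?_
    have hd := Metric.mem_ball.1 hw
    refine (pathEDist_le_edist_of_ball hb (hd.trans_le (min_le_left _ _))).trans_lt ?_
    rw [edist_dist, dist_comm]
    exact (ENNReal.ofReal_le_ofReal (hd.le.trans (min_le_right _ _))).trans_lt hε''.2

theorem proj_mem_closure_squarePts {Δ : DyadicSquare} {m : ℕ} {a : SlitSpace r (m + 1)}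
    (h : a ∈ closure (squarePts r Δ (m + 1))) : proj r m a ∈ closure (squarePts r Δ m) := by
  refine map_mem_closure (lipschitzWith_proj r m).continuous h ?_
  rintro _ ⟨z, hz, rfl⟩
  exact ⟨inclusion r m z, hz, (proj_coe r z).symm⟩

theorem mem_closure_squarePts_of_le (p : Carpet r) {Δ : DyadicSquare} {m m' : ℕ} (h : m ≤ m')
    (hp : p.1 m' ∈ closure (squarePts r Δ m')) : p.1 m ∈ closure (squarePts r Δ m) := by
  induction h with
  | refl => exact hp
  | step _ ih => exact ih (p.2 _ ▸ proj_mem_closure_squarePts r hp)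

/-- Each level `m` provides a square of generation `n`. By pigeonhole one square serves infinitely
many levels, and membership descends to all lower ones. -/
theorem exists_mem_squareCarpet (p : Carpet r) (n : ℕ) :
    ∃ i j : Fin (2 ^ n), p ∈ squareCarpet r ⟨n, i, j⟩ := by
  choose x hx using fun m => exists_mem_closure_squarePts r n m (p.1 m)
  obtain ⟨y, hy⟩ := Finite.exists_infinite_fiber x
  refine ⟨y.1, y.2, fun m => ?_⟩
  obtain ⟨m', hm', hlt⟩ := (Set.infinite_coe_iff.1 hy).exists_gt m
  refine mem_closure_squarePts_of_le r p hlt.le ?_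
  have : x m' = y := hm'
  rw [← this]
  exact hx m'

theorem exists_openSquare_edist_le (p : Carpet r) (n : ℕ) :
    ∃ i j : Fin (2 ^ n), ∀ z (hz : z ∈ genericSet), z ∈ (DyadicSquare.mk n i j).openSquare →
      edist p (genericPt r z hz) ≤ ENNReal.ofReal (5 / 2 ^ n) := by
  obtain ⟨i, j, h⟩ := exists_mem_squareCarpet r p n
  exact ⟨i, j, fun z hz hz' => (Metric.edist_le_ediam_of_mem h
    (genericPt_mem_squareCarpet r hz hz')).trans (ediam_squareCarpet_le r _)⟩

theorem edist_carpet_le (p q : Carpet r) : edist p q ≤ 5 := by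
  obtain ⟨i, j, h⟩ := exists_mem_squareCarpet r p 0
  obtain ⟨i', j', h'⟩ := exists_mem_squareCarpet r q 0
  obtain rfl : i = i' := Subsingleton.elim (α := Fin 1) i i'
  obtain rfl : j = j' := Subsingleton.elim (α := Fin 1) j j'
  simpa using (Metric.edist_le_ediam_of_mem h h').trans (ediam_squareCarpet_le r _)

/-! ### Compactness of the carpet and lifts of points -/

/-- Limits exist at each level, are compatible by continuity of the projections, and the Cauchy
estimates pass to the supremum over levels. -/
instance : CompleteSpace (Carpet r) := by
  refine EMetric.complete_of_cauchySeq_tendsto fun u hu => ?_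
  have h1 : ∀ n, ∃ a, Tendsto (fun k => (u k).1 n) atTop (𝓝 a) := fun n =>
    cauchySeq_tendsto_of_complete
      ((lipschitzWith_carpet_eval r n).uniformContinuous.comp_cauchySeq hu)
  choose a ha using h1
  have hc : ∀ n, proj r n (a (n + 1)) = a n := fun n =>
    tendsto_nhds_unique (((lipschitzWith_proj r n).continuous.tendsto _).comp (ha (n + 1)))
      ((ha n).congr fun k => ((u k).2 n).symm)
  refine ⟨⟨a, hc⟩, EMetric.tendsto_atTop.2 fun ε hε => ?_⟩
  obtain ⟨ε', hε', hlt⟩ := exists_between hε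
  obtain ⟨N, hN⟩ := EMetric.cauchySeq_iff.1 hu ε' hε'
  refine ⟨N, fun k hk => (iSup_le fun n => ?_).trans_lt hlt⟩
  refine le_of_tendsto (tendsto_const_nhds.edist (ha n)) ?_
  filter_upwards [eventually_ge_atTop N] with m hm
  exact (le_iSup (fun n => edist ((u k).1 n) ((u m).1 n)) n).trans (hN k hk m hm).le

/-- The `4 ^ n` pieces over the squares of generation `n` cover the carpet and have diameter at most
`5 / 2 ^ n`. -/
instance : CompactSpace (Carpet r) := by
  refine ⟨isCompact_iff_totallyBounded_isComplete.2 ⟨?_, isComplete_univ⟩⟩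
  refine EMetric.totallyBounded_iff.2 fun ε hε => ?_
  have ht : Tendsto (fun n : ℕ => ENNReal.ofReal (5 / 2 ^ n)) atTop (𝓝 0) := by
    have : Tendsto (fun n : ℕ => (5 : ℝ) / 2 ^ n) atTop (𝓝 0) :=
      tendsto_const_nhds.div_atTop (tendsto_pow_atTop_atTop_of_one_lt one_lt_two)
    simpa using ENNReal.tendsto_ofReal this
  obtain ⟨n, hn⟩ := (ht.eventually_lt_const hε).exists
  choose c hc using fun x : {x : Fin (2 ^ n) × Fin (2 ^ n) //
    (squareCarpet r ⟨n, x.1, x.2⟩).Nonempty} => x.2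
  refine ⟨range c, finite_range c, fun p _ => ?_⟩
  obtain ⟨i, j, h⟩ := exists_mem_squareCarpet r p n
  refine mem_iUnion₂.2 ⟨_, ⟨⟨(i, j), ⟨p, h⟩⟩, rfl⟩, ?_⟩
  exact ((Metric.edist_le_ediam_of_mem h (hc ⟨(i, j), ⟨p, h⟩⟩)).trans
    (ediam_squareCarpet_le r _)).trans_lt hn

/-- By compactness the image of the closure is closed, and it contains the generic points of `U`,
which are dense in `U ∩ unitSquare`. -/
theorem exists_lift {U : Set Plane} (hU : IsOpen U) {z : Plane}
    (hz : z ∈ closure (U ∩ unitSquare)) :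
    ∃ p, toPlane r p = z ∧ p ∈ closure {q : Carpet r | toPlane r q ∈ U} := by
  have hK : IsClosed (toPlane r '' closure {q : Carpet r | toPlane r q ∈ U}) :=
    (isClosed_closure.isCompact.image (continuous_toPlane r)).isClosed
  suffices h : z ∈ toPlane r '' closure {q : Carpet r | toPlane r q ∈ U} by
    obtain ⟨p, hp, rfl⟩ := h
    exact ⟨p, rfl, hp⟩
  refine closure_minimal (fun w hw => ?_) hK hz
  rw [← hK.closure_eq, mem_closure_iff]
  intro V hV hwV
  obtain ⟨x, hx, hg⟩ := exists_generic (hV.inter hU) ⟨w, ⟨hwV, hw.1⟩, hw.2⟩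
  exact ⟨x, hx.1, genericPt r x hg,
    subset_closure (by simpa [toPlane_genericPt] using hx.2), toPlane_genericPt r x hg⟩

theorem mem_closure_of_forall_translate {A : Set Plane} {z v : Plane}
    (h : ∀ᶠ t : ℝ in 𝓝[>] 0, z + t • v ∈ A) : z ∈ closure A := by
  refine mem_closure_of_tendsto (f := fun t : ℝ => z + t • v) (b := 𝓝[>] 0) ?_ h
  have : Continuous fun t : ℝ => z + t • v := by fun_prop
  simpa using (this.tendsto 0).mono_left nhdsWithin_le_nhds

theorem exists_rightLift {z : Plane} (hz : z ∈ unitSquare) : ∃ p, IsRightLift r z p := by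
  refine exists_lift r (U := {w | z 0 < w 0}) (isOpen_Ioi.preimage (continuous_coord 0)) ?_
  refine mem_closure_of_forall_translate (v := !₂[1, 0]) ?_
  filter_upwards [self_mem_nhdsWithin, mem_nhdsWithin_of_mem_nhds
    (Iio_mem_nhds (sub_pos.2 (hz 0).2))] with t ht ht'
  have ht0 : 0 < t := ht
  have ht1 : t < 1 - z 0 := ht'
  refine ⟨by simpa using ht0, fun k => ?_⟩
  fin_cases k
  · simpa using ⟨by linarith [(hz 0).1], by linarith⟩
  · simpa using hz 1

theorem exists_leftLift {z : Plane} (hz : z ∈ unitSquare) : ∃ p, IsLeftLift r z p := by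
  refine exists_lift r (U := {w | w 0 < z 0}) (isOpen_Iio.preimage (continuous_coord 0)) ?_
  refine mem_closure_of_forall_translate (v := !₂[-1, 0]) ?_
  filter_upwards [self_mem_nhdsWithin, mem_nhdsWithin_of_mem_nhds
    (Iio_mem_nhds (hz 0).1)] with t ht ht'
  have ht0 : 0 < t := ht
  have ht1 : t < z 0 := ht'
  refine ⟨by simpa using ht0, fun k => ?_⟩
  fin_cases k
  · simpa using ⟨by linarith, by linarith [(hz 0).2]⟩
  · simpa using hz 1

theorem zero_mem_squareBoundary : (0 : Plane) ∈ squareBoundary := by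
  simp [squareBoundary]

theorem exists_toPlane_eq_zero : ∃ p : Carpet r, toPlane r p = 0 := by
  obtain ⟨p, hp, -⟩ := exists_lift r (U := univ) isOpen_univ (z := 0)
    (mem_closure_of_forall_translate (v := !₂[1, 1]) (by
      filter_upwards [Ioo_mem_nhdsGT (zero_lt_one' ℝ)] with t ht
      refine ⟨trivial, fun k => ?_⟩
      fin_cases k <;> simpa using ht))
  exact ⟨p, hp⟩

/-! ### Fibres of the projection -/

theorem mem_squareBoundary_or_unitSquare (p : Carpet r) :
    toPlane r p ∈ squareBoundary ∨ toPlane r p ∈ unitSquare := by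
  by_cases h : toPlane r p ∈ unitSquare
  · exact Or.inr h
  · left
    refine ⟨toPlane_mem_Icc r p, ?_⟩
    by_contra! hc
    exact h fun k => ⟨(toPlane_mem_Icc r p k).1.lt_of_ne (hc k).1.symm,
      (toPlane_mem_Icc r p k).2.lt_of_ne (hc k).2⟩

/-- Close to a point of the open set `S_n` the path distance is at most the Euclidean one, so
completing adds no new point over it. -/
theorem carpet_val_eq_of_mem_slitDomain {n : ℕ} {z : Plane} (hz : z ∈ slitDomain r n)
    {a : SlitSpace r n} (ha : planeProj r n a = z) :
    a = ofMem r hz := by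
  obtain ⟨δ, hδ, hb⟩ := Metric.isOpen_iff.1 (isOpen_slitDomain r n) z hz
  have hc := (lipschitzWith_planeProj r n).continuous
  -- Written as a disjunction of closed conditions, the implication extends from `S_n` to its
  -- completion.
  have key : ∀ a : SlitSpace r n, δ ≤ dist (planeProj r n a) z ∨
      edist (ofMem r hz) a ≤ edist z (planeProj r n a) := by
    intro a
    induction a using Completion.induction_on with
    | hp =>
      exact (isClosed_le continuous_const (hc.dist continuous_const)).union
        (isClosed_le (continuous_const.edist continuous_id) (continuous_const.edist hc))
    | ih w =>
      rw [planeProj_coe]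
      exact (le_or_gt δ (dist w.1 z)).imp_right fun h =>
        (edist_slitPoint r _ _).trans_le (pathEDist_le_edist_of_ball hb h)
  rcases key a with h | h
  · rw [ha, dist_self] at h
    exact absurd hδ (not_lt.2 h)
  · rw [ha, edist_self] at h
    exact (edist_le_zero.1 h).symm

theorem eq_of_toPlane_eq {p q : Carpet r} (h : toPlane r p = toPlane r q)
    (hu : toPlane r p ∈ unitSquare) (hs : ∀ Δ, toPlane r p ∉ slit r Δ) : p = q := by
  refine Subtype.ext (funext fun n => ?_)
  have hz : toPlane r p ∈ slitDomain r n := (mem_slitDomain r).2 ⟨hu, fun Δ _ => hs Δ⟩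
  exact (carpet_val_eq_of_mem_slitDomain r hz (toPlane_eq r p n).symm).trans
    (carpet_val_eq_of_mem_slitDomain r hz ((toPlane_eq r q n).symm.trans h.symm)).symm

/-- The point is a limit of generic points in arbitrarily fine squares, and fine squares lie
strictly on one side of the line carrying the slit. -/
theorem isRightLift_or_isLeftLift {Δ : DyadicSquare} {p : Carpet r} {z : Plane}
    (hp : toPlane r p = z) (hz : z 0 = Δ.centerX) :
    IsRightLift r z p ∨ IsLeftLift r z p := by
  by_contra! hc
  have h1 : p ∉ closure {q : Carpet r | z 0 < toPlane r q 0} := fun h => hc.1 ⟨hp, h⟩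
  have h2 : p ∉ closure {q : Carpet r | toPlane r q 0 < z 0} := fun h => hc.2 ⟨hp, h⟩
  rw [EMetric.mem_closure_iff] at h1 h2
  push Not at h1 h2
  obtain ⟨ε, hε, h1⟩ := h1
  obtain ⟨ε', hε', h2⟩ := h2
  have ht : Tendsto (fun n : ℕ => ENNReal.ofReal (5 / 2 ^ n)) atTop (𝓝 0) := by
    have : Tendsto (fun n : ℕ => (5 : ℝ) / 2 ^ n) atTop (𝓝 0) :=
      tendsto_const_nhds.div_atTop (tendsto_pow_atTop_atTop_of_one_lt one_lt_two)
    simpa using ENNReal.tendsto_ofReal this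
  obtain ⟨n, hn, hlt⟩ := ((ht.eventually_lt_const (lt_min hε hε')).and
    (eventually_gt_atTop Δ.gen)).exists
  obtain ⟨i, j, h⟩ := exists_openSquare_edist_le r p n
  obtain ⟨w, hw, hg⟩ : ∃ w ∈ (DyadicSquare.mk n i j).openSquare, w ∈ genericSet :=
    exists_generic_openSquare _
  have hd := (h w hg hw).trans_lt hn
  rcases lt_trichotomy (z 0) (w 0) with hl | he | hl
  · exact absurd (hd.trans_le (min_le_left _ _))
      (not_lt.2 (h1 _ (by simpa [toPlane_genericPt] using hl)))
  · rw [he] at hz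
    exact Δ.centerX_notMem_Ioo hlt i (hz ▸ hw.1)
  · exact absurd (hd.trans_le (min_le_right _ _))
      (not_lt.2 (h2 _ (by simpa [toPlane_genericPt] using hl)))

/-! ### Slits and pillowcases -/

theorem slitPt_mem_slit {Δ : DyadicSquare} {t : ℝ} (ht : t ∈ Icc 0 (slitLength r Δ)) :
    slitPt r Δ t ∈ slit r Δ :=
  ⟨rfl, by simpa [slitPt] using ht⟩

theorem slitPt_mem_unitSquare {Δ : DyadicSquare} {t : ℝ} (ht : t ∈ Icc 0 (slitLength r Δ)) :
    slitPt r Δ t ∈ unitSquare :=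
  fun k => slit_subset_unitSquare r (slitPt_mem_slit r ht) k

theorem slitLength_le_one (Δ : DyadicSquare) : slitLength r Δ ≤ 1 :=
  div_le_one_of_le₀ ((r Δ.gen).2.2.le.trans (one_le_pow₀ one_le_two)) (by positivity)

theorem dist_slitPt (Δ : DyadicSquare) (t t' : ℝ) : dist (slitPt r Δ t) (slitPt r Δ t') = |t - t'| := by
  rw [EuclideanSpace.dist_eq, Fin.sum_univ_two, Real.dist_eq, Real.dist_eq]
  simp [slitPt, Real.sqrt_sq_eq_abs]

theorem lipschitzWith_slitPt_height (s : SlitIndex) :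
    LipschitzWith 1 fun c : Rect (slitLength r s.2) => slitPt r s.2 (c.1 1) :=
  LipschitzWith.mk_one fun c c' => (dist_slitPt r _ _ _).trans_le (abs_coord_sub_le_dist c.1 c'.1 1)

/-! ### Lipschitz functions on the surface -/

/-- A function of the projection extends to each pillowcase by collapsing it vertically onto its
slit. The gluing is respected because both sides of a slit have the same projection. -/
theorem exists_lift_of_plane {Y : Type*} [PseudoEMetricSpace Y] (φ : Bool → Plane → Y)
    (hφ : ∀ b, LipschitzWith 1 (φ b)) (hb : ∀ z ∈ squareBoundary, φ false z = φ true z) :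
    ∃ F : Surface r → Y, (∀ b p, F (carpetPt r b p) = φ b (toPlane r p)) ∧
      (∀ s c, F (pillowPt r s c) = φ s.1 (slitPt r s.2 (c.1 1))) ∧
      ∀ x y, edist (F x) (F y) ≤ surfaceEDist r x y := by
  refine exists_surface_lift r (fun b p => φ b (toPlane r p))
    (fun s c => φ s.1 (slitPt r s.2 (c.1 1))) (fun b => ?_) (fun s => ?_) ?_ ?_ ?_ ?_
  · rw [← one_mul (1 : NNReal)]
    exact (hφ b).comp (lipschitzWith_toPlane r)
  · rw [← one_mul (1 : NNReal)]
    exact (hφ s.1).comp (lipschitzWith_slitPt_height r s)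
  · intro b b' p q h h'
    have := hb _ h'
    simp only [← h]
    cases b <;> cases b' <;> simp [this]
  · intro s c c' _ h _
    simp only [h]
  · intro s c p _ hp
    simp only [hp.1]
  · intro s c p _ hp
    simp only [hp.1]

/-- The target is `ℝ × ℝ` with the supremum metric, for which `μH[2]` is exactly Lebesgue measure.
-/
theorem exists_surfaceProj : ∃ F : Surface r → ℝ × ℝ,
    (∀ b p, F (carpetPt r b p) = (toPlane r p 0, toPlane r p 1)) ∧
      (∀ s c, F (pillowPt r s c) = (s.2.centerX, slitBottom r s.2 + c.1 1)) ∧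
      ∀ x y, edist (F x) (F y) ≤ surfaceEDist r x y :=
  exists_lift_of_plane r (fun _ z => (z 0, z 1)) (fun _ => LipschitzWith.mk_one fun z w =>
    max_le (abs_coord_sub_le_dist z w 0) (abs_coord_sub_le_dist z w 1)) fun _ _ => rfl

/-- The distance to the boundary of the unit square. -/
def boundaryDist (z : Plane) : ℝ := min (min (z 0) (1 - z 0)) (min (z 1) (1 - z 1))

theorem abs_boundaryDist_sub_le (z w : Plane) : |boundaryDist z - boundaryDist w| ≤ dist z w := by
  have h : ∀ k, |min (z k) (1 - z k) - min (w k) (1 - w k)| ≤ dist z w := fun k => by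
    refine (abs_min_sub_min_le_max _ _ _ _).trans (max_le (abs_coord_sub_le_dist z w k) ?_)
    rw [sub_sub_sub_cancel_left, abs_sub_comm]
    exact abs_coord_sub_le_dist z w k
  exact (abs_min_sub_min_le_max _ _ _ _).trans (max_le (h 0) (h 1))

theorem boundaryDist_eq_zero {z : Plane} (hz : z ∈ squareBoundary) : boundaryDist z = 0 := by
  obtain ⟨h, k, hk⟩ := hz
  have h0 := h 0
  have h1 := h 1
  refine le_antisymm ?_ (le_min (le_min h0.1 (by linarith [h0.2])) (le_min h1.1 (by linarith [h1.2])))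
  fin_cases k
  · refine (min_le_left _ _).trans ?_
    rcases hk with hk | hk
    · exact (min_le_left _ _).trans hk.le
    · exact (min_le_right _ _).trans (sub_nonpos.2 hk.ge)
  · refine (min_le_right _ _).trans ?_
    rcases hk with hk | hk
    · exact (min_le_left _ _).trans hk.le
    · exact (min_le_right _ _).trans (sub_nonpos.2 hk.ge)

theorem boundaryDist_pos {z : Plane} (hz : z ∈ unitSquare) : 0 < boundaryDist z :=
  lt_min (lt_min (hz 0).1 (sub_pos.2 (hz 0).2)) (lt_min (hz 1).1 (sub_pos.2 (hz 1).2))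

/-- It tells the two copies apart over the open square, and vanishes where they are identified. -/
theorem exists_signed_boundaryDist : ∃ F : Surface r → ℝ,
    (∀ b p, F (carpetPt r b p) = (if b then 1 else -1) * boundaryDist (toPlane r p)) ∧
      ∀ x y, edist (F x) (F y) ≤ surfaceEDist r x y := by
  have hφ : ∀ b : Bool, LipschitzWith 1 fun z => (if b then (1 : ℝ) else -1) * boundaryDist z := by
    refine fun b => LipschitzWith.mk_one fun z w => ?_
    rw [Real.dist_eq, ← mul_sub, abs_mul]
    refine le_trans (le_of_eq ?_) (abs_boundaryDist_sub_le z w)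
    cases b <;> simp
  obtain ⟨F, h, -, h'⟩ := exists_lift_of_plane r _ hφ
    (fun z hz => by simp [boundaryDist_eq_zero hz])
  exact ⟨F, h, h'⟩

open Classical in
/-- The distance to the boundary inside one pillowcase. -/
theorem exists_depth (s : SlitIndex) : ∃ F : Surface r → ℝ,
    (∀ b p, F (carpetPt r b p) = 0) ∧
      (∀ s' c, F (pillowPt r s' c) = if s' = s then slitLength r s'.2 - |c.1 0| else 0) ∧
      ∀ x y, edist (F x) (F y) ≤ surfaceEDist r x y := by
  refine exists_surface_lift r (fun _ _ => 0)
    (fun s' c => if s' = s then slitLength r s'.2 - |c.1 0| else 0)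
    (fun _ => LipschitzWith.const' 0) (fun s' => ?_) (fun _ _ _ _ _ _ => rfl) ?_ ?_ ?_
  · by_cases h : s' = s
    · simp only [if_pos h]
      refine LipschitzWith.mk_one fun c c' => ?_
      rw [Real.dist_eq, sub_sub_sub_cancel_left, abs_sub_comm]
      exact (abs_abs_sub_abs_le_abs_sub _ _).trans (abs_coord_sub_le_dist c.1 c'.1 0)
    · simpa only [if_neg h] using LipschitzWith.const' (0 : ℝ)
  · intro s' c c' h _ _
    simp [h]
  · intro s' c p h _
    simp [h, abs_of_pos (slitLength_pos r s'.2)]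
  · intro s' c p h _
    simp [h, abs_of_pos (slitLength_pos r s'.2)]

/-! ### Tent functions: separating the two sides of a slit -/

/-- A tent function over a slit. -/
def tent (Δ : DyadicSquare) (z : Plane) : ℝ :=
  max 0 (min (z 1 - slitBottom r Δ) (slitBottom r Δ + slitLength r Δ - z 1) - |z 0 - Δ.centerX|) / 2

/-- The tent function, with opposite signs on the two sides of the slit. -/
def signedTent (Δ : DyadicSquare) (z : Plane) : ℝ := Real.sign (z 0 - Δ.centerX) * tent r Δ z

theorem tent_nonneg (Δ : DyadicSquare) (z : Plane) : 0 ≤ tent r Δ z := by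
  unfold tent; positivity

theorem abs_tent_sub_le (Δ : DyadicSquare) (z w : Plane) :
    |tent r Δ z - tent r Δ w| ≤ dist z w := by
  have h0 := abs_coord_sub_le_dist z w 0
  have h1 := abs_coord_sub_le_dist z w 1
  rw [tent, tent, ← sub_div, abs_div, abs_two, div_le_iff₀ two_pos]
  refine (abs_max_sub_max_le_max _ _ _ _).trans (max_le (by simp) ?_)
  set a := min (z 1 - slitBottom r Δ) (slitBottom r Δ + slitLength r Δ - z 1)
  set b := min (w 1 - slitBottom r Δ) (slitBottom r Δ + slitLength r Δ - w 1)
  have hab : |a - b| ≤ dist z w := by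
    refine (abs_min_sub_min_le_max _ _ _ _).trans (max_le (by simpa using h1) ?_)
    rw [sub_sub_sub_cancel_left, abs_sub_comm]
    exact h1
  have hx : |abs (z 0 - Δ.centerX) - abs (w 0 - Δ.centerX)| ≤ dist z w := by
    refine (abs_abs_sub_abs_le_abs_sub _ _).trans (by simpa using h0)
  rw [abs_le] at *
  constructor <;> linarith [hab.1, hab.2, hx.1, hx.2]

theorem tent_eq_zero {Δ : DyadicSquare} {z : Plane} (h : z 0 = Δ.centerX) (hz : z ∉ slit r Δ) :
    tent r Δ z = 0 := by
  rw [tent, max_eq_left, zero_div]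
  rw [h, sub_self, abs_zero, sub_zero, min_le_iff]
  by_contra! hc
  exact hz ⟨h, by linarith [hc.1], by linarith [hc.2]⟩

theorem tent_slitPt {Δ : DyadicSquare} {t : ℝ} (ht : t ∈ Icc 0 (slitLength r Δ)) :
    tent r Δ (slitPt r Δ t) = min t (slitLength r Δ - t) / 2 := by
  have e : slitBottom r Δ + slitLength r Δ - (slitBottom r Δ + t) = slitLength r Δ - t := by ring
  simp only [tent, slitPt, Matrix.cons_val_zero, Matrix.cons_val_one, Matrix.cons_val_fin_one,
    sub_self, abs_zero, sub_zero, add_sub_cancel_left, e]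
  rw [max_eq_right (le_min ht.1 (sub_nonneg.2 ht.2))]

theorem abs_sign_le_one (x : ℝ) : |Real.sign x| ≤ 1 := by
  rcases Real.sign_apply_eq x with h | h | h <;> simp [h]

theorem abs_signedTent_le (Δ : DyadicSquare) (z : Plane) : |signedTent r Δ z| ≤ tent r Δ z := by
  rw [signedTent, abs_mul, abs_of_nonneg (tent_nonneg r Δ z)]
  exact mul_le_of_le_one_left (tent_nonneg r Δ z) (abs_sign_le_one _)

/-- If the signs agree, the tent itself is `1`-Lipschitz. Otherwise any curve in the slit domain
meets the vertical line through the slit, necessarily off the slit, hence at a zero of the tent. The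
two halves of the curve then bound the two values separately. -/
theorem edist_signedTent_le {Δ : DyadicSquare} {n : ℕ} (hn : Δ.gen < n) (z w : Plane) :
    edist (signedTent r Δ z) (signedTent r Δ w) ≤ pathEDist (slitDomain r n) z w := by
  by_cases hs : (Real.sign (z 0 - Δ.centerX) = Real.sign (w 0 - Δ.centerX))
  · refine le_trans ?_ (edist_le_pathEDist _ _ _)
    rw [edist_dist, edist_dist]
    refine ENNReal.ofReal_le_ofReal ?_
    rw [Real.dist_eq, signedTent, signedTent, hs, ← mul_sub, abs_mul]
    exact (mul_le_of_le_one_left (abs_nonneg _) (abs_sign_le_one _)).trans (abs_tent_sub_le r Δ z w)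
  · have hx : Δ.centerX ∈ uIcc (z 0) (w 0) := by
      rw [mem_uIcc]
      by_contra! hc
      rcases le_or_gt (z 0) Δ.centerX with h | h
      · have h2 := hc.1 h
        have h3 : z 0 < Δ.centerX := lt_of_le_of_ne h fun e => by
          have := hc.2 h2.le
          linarith
        exact hs (by rw [Real.sign_of_neg (sub_neg.2 h3), Real.sign_of_neg (sub_neg.2 h2)])
      · have h2 : Δ.centerX < w 0 := by
          by_contra! h4
          have := hc.2 h4
          linarith
        exact hs (by rw [Real.sign_of_pos (sub_pos.2 h), Real.sign_of_pos (sub_pos.2 h2)])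
    refine le_iInf fun γ => le_iInf fun h1 => le_iInf fun h2 => le_iInf fun h3 => le_iInf fun h4 => ?_
    have hc : ContinuousOn (fun t => γ t 0) (uIcc 0 1) := by
      rw [uIcc_of_le zero_le_one]
      exact (continuous_coord 0).comp_continuousOn h1
    obtain ⟨t, ht, htx⟩ := intermediate_value_uIcc hc (show Δ.centerX ∈ uIcc (γ 0 0) (γ 1 0) by
      rwa [h3, h4])
    rw [uIcc_of_le zero_le_one] at ht
    have ht0 : tent r Δ (γ t) = 0 :=
      tent_eq_zero r htx (((mem_slitDomain r).1 (h2 ht)).2 Δ hn)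
    have key : ∀ v, edist (signedTent r Δ v) 0 ≤ edist v (γ t) := fun v => by
      rw [edist_dist, edist_dist]
      refine ENNReal.ofReal_le_ofReal ?_
      rw [Real.dist_0_eq_abs]
      refine (abs_signedTent_le r Δ v).trans ?_
      have := abs_tent_sub_le r Δ v (γ t)
      rwa [ht0, sub_zero, abs_of_nonneg (tent_nonneg r Δ v)] at this
    have hv := eVariationOn.Icc_add_Icc γ (s := Icc 0 1) ht.1 ht.2 ht
    rw [inter_self] at hv
    rw [← hv, ← h3, ← h4]
    refine (edist_triangle _ 0 _).trans (add_le_add ((key _).trans ?_) ?_)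
    · exact eVariationOn.edist_le γ ⟨⟨le_rfl, zero_le_one⟩, le_rfl, ht.1⟩ ⟨ht, ht.1, le_rfl⟩
    · rw [edist_comm]
      refine (key _).trans ?_
      exact eVariationOn.edist_le γ ⟨⟨zero_le_one, le_rfl⟩, ht.2, le_rfl⟩ ⟨ht, le_rfl, ht.2⟩

theorem lipschitzWith_signedTent (Δ : DyadicSquare) :
    LipschitzWith 1 (fun z : SlitPoint r (Δ.gen + 1) => signedTent r Δ z.1) :=
  LipschitzWith.of_edist_le fun z w => edist_signedTent_le r (Nat.lt_succ_self _) z.1 w.1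

/-- The signed tent function on the completed slit domain. -/
def slitSpaceTent (Δ : DyadicSquare) : SlitSpace r (Δ.gen + 1) → ℝ :=
  Completion.extension fun z : SlitPoint r (Δ.gen + 1) => signedTent r Δ z.1

theorem lipschitzWith_slitSpaceTent (Δ : DyadicSquare) : LipschitzWith 1 (slitSpaceTent r Δ) :=
  (lipschitzWith_signedTent r Δ).completion_extension

theorem slitSpaceTent_coe (Δ : DyadicSquare) (z : SlitPoint r (Δ.gen + 1)) :
    slitSpaceTent r Δ z = signedTent r Δ z.1 :=
  Completion.extension_coe (lipschitzWith_signedTent r Δ).uniformContinuous z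

/-- The signed tent function on the carpet. -/
def carpetTent (Δ : DyadicSquare) (p : Carpet r) : ℝ := slitSpaceTent r Δ (p.1 (Δ.gen + 1))

theorem lipschitzWith_carpetTent (Δ : DyadicSquare) : LipschitzWith 1 (carpetTent r Δ) := by
  rw [← one_mul (1 : NNReal)]
  exact (lipschitzWith_slitSpaceTent r Δ).comp (lipschitzWith_carpet_eval r _)

theorem continuous_tent (Δ : DyadicSquare) : Continuous (tent r Δ) :=
  (LipschitzWith.mk_one (abs_tent_sub_le r Δ)).continuous

theorem carpetTent_of_gt (Δ : DyadicSquare) (p : Carpet r) (h : Δ.centerX < toPlane r p 0) :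
    carpetTent r Δ p = tent r Δ (toPlane r p) := by
  have hc := (lipschitzWith_planeProj r (Δ.gen + 1)).continuous
  -- Again a disjunction of closed conditions, so that it can be checked on the dense slit domain.
  have key : ∀ a, planeProj r (Δ.gen + 1) a 0 ≤ Δ.centerX ∨
      slitSpaceTent r Δ a = tent r Δ (planeProj r _ a) := by
    intro a
    induction a using Completion.induction_on with
    | hp =>
      exact (isClosed_le ((continuous_coord 0).comp hc) continuous_const).union
        (isClosed_eq (lipschitzWith_slitSpaceTent r Δ).continuous ((continuous_tent r Δ).comp hc))
    | ih z =>
      rw [planeProj_coe, slitSpaceTent_coe]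
      refine (le_or_gt _ _).imp_right fun h => ?_
      rw [signedTent, Real.sign_of_pos (sub_pos.2 h), one_mul]
  rw [toPlane_eq r p (Δ.gen + 1)] at h ⊢
  exact (key _).resolve_left (not_le.2 h)

theorem carpetTent_of_lt (Δ : DyadicSquare) (p : Carpet r) (h : toPlane r p 0 < Δ.centerX) :
    carpetTent r Δ p = -tent r Δ (toPlane r p) := by
  have hc := (lipschitzWith_planeProj r (Δ.gen + 1)).continuous
  have key : ∀ a, Δ.centerX ≤ planeProj r (Δ.gen + 1) a 0 ∨
      slitSpaceTent r Δ a = -tent r Δ (planeProj r _ a) := by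
    intro a
    induction a using Completion.induction_on with
    | hp =>
      exact (isClosed_le continuous_const ((continuous_coord 0).comp hc)).union
        (isClosed_eq (lipschitzWith_slitSpaceTent r Δ).continuous
          ((continuous_tent r Δ).comp hc).neg)
    | ih z =>
      rw [planeProj_coe, slitSpaceTent_coe]
      refine (le_or_gt _ _).imp_right fun h => ?_
      rw [signedTent, Real.sign_of_neg (sub_neg.2 h), neg_one_mul]
  rw [toPlane_eq r p (Δ.gen + 1)] at h ⊢
  exact (key _).resolve_left (not_le.2 h)

theorem abs_carpetTent_le (Δ : DyadicSquare) (p : Carpet r) :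
    |carpetTent r Δ p| ≤ tent r Δ (toPlane r p) := by
  have hc := (lipschitzWith_planeProj r (Δ.gen + 1)).continuous
  have key : ∀ a, |slitSpaceTent r Δ a| ≤ tent r Δ (planeProj r (Δ.gen + 1) a) := by
    intro a
    induction a using Completion.induction_on with
    | hp =>
      exact isClosed_le (lipschitzWith_slitSpaceTent r Δ).continuous.abs
        ((continuous_tent r Δ).comp hc)
    | ih z =>
      rw [planeProj_coe, slitSpaceTent_coe]
      exact abs_signedTent_le r Δ z.1
  rw [toPlane_eq r p (Δ.gen + 1)]
  exact key _

theorem carpetTent_eq {Δ : DyadicSquare} {p : Carpet r} (h : toPlane r p ∉ slit r Δ) :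
    carpetTent r Δ p = signedTent r Δ (toPlane r p) := by
  rcases lt_trichotomy (toPlane r p 0) Δ.centerX with h' | h' | h'
  · rw [carpetTent_of_lt r Δ p h', signedTent, Real.sign_of_neg (sub_neg.2 h'), neg_one_mul]
  · have := abs_carpetTent_le r Δ p
    rw [tent_eq_zero r h' h] at this
    rw [abs_nonpos_iff.1 this, signedTent, tent_eq_zero r h' h, mul_zero]
  · rw [carpetTent_of_gt r Δ p h', signedTent, Real.sign_of_pos (sub_pos.2 h'), one_mul]

theorem carpetTent_of_isRightLift {Δ : DyadicSquare} {z : Plane} {p : Carpet r}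
    (hz : z 0 = Δ.centerX) (hp : IsRightLift r z p) : carpetTent r Δ p = tent r Δ z := by
  have : closure {q : Carpet r | z 0 < toPlane r q 0} ⊆
      {q | carpetTent r Δ q = tent r Δ (toPlane r q)} :=
    closure_minimal (fun q hq => carpetTent_of_gt r Δ q (hz ▸ hq))
      (isClosed_eq (lipschitzWith_carpetTent r Δ).continuous
        ((continuous_tent r Δ).comp (continuous_toPlane r)))
  rw [← hp.1]
  exact this hp.2

theorem carpetTent_of_isLeftLift {Δ : DyadicSquare} {z : Plane} {p : Carpet r}
    (hz : z 0 = Δ.centerX) (hp : IsLeftLift r z p) : carpetTent r Δ p = -tent r Δ z := by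
  have : closure {q : Carpet r | toPlane r q 0 < z 0} ⊆
      {q | carpetTent r Δ q = -tent r Δ (toPlane r q)} :=
    closure_minimal (fun q hq => carpetTent_of_lt r Δ q (hz ▸ hq))
      (isClosed_eq (lipschitzWith_carpetTent r Δ).continuous
        ((continuous_tent r Δ).comp (continuous_toPlane r)).neg)
  rw [← hp.1]
  exact this hp.2

/-- A function on the rectangle of a pillowcase that separates its two faces. -/
def faceFun (l : ℝ) (c : Rect l) : ℝ := c.1 0 / l * (min (c.1 1) (l - c.1 1) / 2)

theorem lipschitzWith_faceFun {l : ℝ} (hl : 0 < l) : LipschitzWith 1 (faceFun l) := by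
  refine LipschitzWith.mk_one fun c c' => ?_
  have h0 := abs_coord_sub_le_dist c.1 c'.1 0
  have h1 := abs_coord_sub_le_dist c.1 c'.1 1
  have hu : |c.1 0 / l| ≤ 1 := by
    rw [abs_div, abs_of_pos hl, div_le_one hl]
    exact abs_le.2 c.2.1
  set m := min (c.1 1) (l - c.1 1)
  set m' := min (c'.1 1) (l - c'.1 1)
  have hm : |m - m'| ≤ dist c.1 c'.1 := by
    refine (abs_min_sub_min_le_max _ _ _ _).trans (max_le h1 ?_)
    rw [sub_sub_sub_cancel_left, abs_sub_comm]
    exact h1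
  have hm' : |m' / l| ≤ 1 := by
    rw [abs_div, abs_of_pos hl, div_le_one hl, abs_of_nonneg (le_min c'.2.2.1 (sub_nonneg.2 c'.2.2.2))]
    exact (min_le_left _ _).trans c'.2.2.2
  -- Product rule with both factors bounded by `1`. The factor `1 / 2` in `faceFun` absorbs the sum
  -- of the two terms.
  have e : c.1 0 / l * (m / 2) - c'.1 0 / l * (m' / 2) =
      (c.1 0 / l * (m - m') + m' / l * (c.1 0 - c'.1 0)) / 2 := by ring
  change |c.1 0 / l * (m / 2) - c'.1 0 / l * (m' / 2)| ≤ dist c.1 c'.1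
  rw [e, abs_div, abs_two, div_le_iff₀ two_pos]
  refine (abs_add_le _ _).trans ?_
  rw [abs_mul, abs_mul]
  have a1 := mul_le_mul hu hm (abs_nonneg _) zero_le_one
  have a2 := mul_le_mul hm' h0 (abs_nonneg _) zero_le_one
  linarith

-- On the vertical sides of the pillowcase `faceFun` equals `± min t (l - t) / 2`, which are the
-- one-sided values of the signed tent. All other slits are disjoint from that of `Δ`, so their
-- pillowcases can be collapsed without ambiguity.
open Classical in
theorem exists_tent (Δ : DyadicSquare) : ∃ F : Surface r → ℝ,
    (∀ b p, F (carpetPt r b p) = carpetTent r Δ p) ∧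
      (∀ s c, F (pillowPt r s c) = if s.2 = Δ then faceFun _ c else
        signedTent r Δ (slitPt r s.2 (c.1 1))) ∧
      ∀ x y, edist (F x) (F y) ≤ surfaceEDist r x y := by
  have hne : ∀ (s : SlitIndex) (c : Rect (slitLength r s.2)), ¬ s.2 = Δ →
      slitPt r s.2 (c.1 1) ∉ slit r Δ := fun s c h hc =>
    h (eq_of_mem_slit r (slitPt_mem_slit r c.2.2) hc)
  refine exists_surface_lift r (fun _ p => carpetTent r Δ p) (fun s c => if s.2 = Δ then faceFun _ c
    else signedTent r Δ (slitPt r s.2 (c.1 1))) (fun _ => lipschitzWith_carpetTent r Δ)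
    (fun s => ?_) ?_ ?_ ?_ ?_
  · by_cases h : s.2 = Δ
    · simpa only [if_pos h] using lipschitzWith_faceFun (slitLength_pos r s.2)
    · simp only [if_neg h]
      refine LipschitzWith.mk_one fun c c' => ?_
      rw [Real.dist_eq, signedTent, signedTent,
        show slitPt r s.2 (c'.1 1) 0 = slitPt r s.2 (c.1 1) 0 from rfl, ← mul_sub, abs_mul]
      refine (mul_le_of_le_one_left (abs_nonneg _) (abs_sign_le_one _)).trans
        ((abs_tent_sub_le r Δ _ _).trans ?_)
      rw [dist_slitPt]
      exact abs_coord_sub_le_dist c.1 c'.1 1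
  · intro b b' p q h hb
    have hp : toPlane r p ∉ slit r Δ := by
      intro hs
      obtain ⟨k, hk⟩ := hb.2
      have := slit_subset_unitSquare r hs k
      rcases hk with hk | hk <;> rw [hk] at this
      · exact lt_irrefl _ this.1
      · exact lt_irrefl _ this.2
    rw [carpetTent_eq r hp, carpetTent_eq r (h ▸ hp), h]
  · intro s c c' _ h h'
    by_cases hs : s.2 = Δ
    · simp only [if_pos hs, faceFun, ← h]
      have : min (c.1 1) (slitLength r s.2 - c.1 1) = 0 := by
        have := slitLength_pos r s.2
        rcases h' with h' | h' <;> rw [h'] <;> simp [this.le]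
      simp [this]
    · simp only [if_neg hs, h]
  · intro s c p h hp
    by_cases hs : s.2 = Δ
    · subst hs
      rw [if_pos rfl, carpetTent_of_isRightLift r rfl hp, tent_slitPt r c.2.2, faceFun, h,
        div_self (slitLength_pos r _).ne', one_mul]
    · rw [if_neg hs, carpetTent_eq r (hp.1 ▸ hne s c hs), hp.1]
  · intro s c p h hp
    by_cases hs : s.2 = Δ
    · subst hs
      rw [if_pos rfl, carpetTent_of_isLeftLift r rfl hp, tent_slitPt r c.2.2, faceFun, h,
        neg_div, div_self (slitLength_pos r _).ne', neg_one_mul]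
    · rw [if_neg hs, carpetTent_eq r (hp.1 ▸ hne s c hs), hp.1]

/-! ### The distance of the surface is a metric -/

/-- The point `(x, y)` of the rectangle of a pillowcase. -/
def rectPt {l : ℝ} (x y : ℝ) (hx : x ∈ Icc (-l) l) (hy : y ∈ Icc 0 l) : Rect l :=
  ⟨!₂[x, y], hx, hy⟩

theorem exists_carpetPt_eq_pillowPt {s : SlitIndex} {c : Rect (slitLength r s.2)}
    (hc : |c.1 0| = slitLength r s.2) : ∃ p, pillowPt r s c = carpetPt r s.1 p := by
  have hu := slitPt_mem_unitSquare r c.2.2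
  rcases eq_or_eq_neg_of_abs_eq hc with h | h
  · obtain ⟨p, hp⟩ := exists_rightLift r hu
    exact ⟨p, pillowPt_eq_of_right r h hp⟩
  · obtain ⟨p, hp⟩ := exists_leftLift r hu
    exact ⟨p, pillowPt_eq_of_left r h hp⟩

theorem exists_surfaceEDist_carpetPt_le (s : SlitIndex) (c : Rect (slitLength r s.2)) :
    ∃ p, surfaceEDist r (pillowPt r s c) (carpetPt r s.1 p) ≤
      ENNReal.ofReal (2 * slitLength r s.2) := by
  have hl := slitLength_pos r s.2
  -- A horizontal move to the right edge, of length at most the width `2 l` of the rectangle.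
  let c' : Rect (slitLength r s.2) := rectPt (slitLength r s.2) (c.1 1) ⟨by linarith, le_rfl⟩ c.2.2
  obtain ⟨p, hp⟩ := exists_carpetPt_eq_pillowPt r (c := c') (abs_of_pos hl)
  refine ⟨p, hp ▸ (surfaceEDist_pillowPt_le r s c c').trans ?_⟩
  change edist c.1 c'.1 ≤ _
  rw [edist_dist]
  refine ENNReal.ofReal_le_ofReal ((dist_le_abs_add_abs _ _).trans ?_)
  have : |c.1 0 - slitLength r s.2| ≤ 2 * slitLength r s.2 := by
    rw [abs_le]; constructor <;> linarith [c.2.1.1, c.2.1.2]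
  simpa [c', rectPt] using this

/-- The two copies are joined through a point over the corner `(0, 0)`, at distance at most `5` from
any point of either copy. -/
theorem surfaceEDist_carpetPt_carpetPt_le (b b' : Bool) (p q : Carpet r) :
    surfaceEDist r (carpetPt r b p) (carpetPt r b' q) ≤ 10 := by
  obtain ⟨o, ho⟩ := exists_toPlane_eq_zero r
  refine (surfaceEDist_triangle r _ (carpetPt r b o) _).trans ?_
  rw [carpetPt_eq_of_boundary r (b := b) (b' := b') (rfl : toPlane r o = toPlane r o)
    (ho ▸ zero_mem_squareBoundary)]
  refine (add_le_add ?_ ((surfaceEDist_carpetPt_le r b' o q).trans (edist_carpet_le r _ _))).trans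
    (show (5 : ℝ≥0∞) + 5 ≤ 10 by norm_num)
  rw [← carpetPt_eq_of_boundary r (b := b) (b' := b') (rfl : toPlane r o = toPlane r o)
    (ho ▸ zero_mem_squareBoundary)]
  exact (surfaceEDist_carpetPt_le r b p o).trans (edist_carpet_le r _ _)

theorem exists_surfaceEDist_carpetPt_le_two (x : Surface r) :
    ∃ b p, surfaceEDist r x (carpetPt r b p) ≤ 2 := by
  induction x using surface_cases with
  | h1 b p => exact ⟨b, p, by simp [surfaceEDist_self]⟩
  | h2 s c =>
    obtain ⟨p, hp⟩ := exists_surfaceEDist_carpetPt_le r s c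
    refine ⟨s.1, p, hp.trans ?_⟩
    rw [← ENNReal.ofReal_ofNat]
    exact ENNReal.ofReal_le_ofReal (by linarith [slitLength_le_one r s.2])

theorem surfaceEDist_le (x y : Surface r) : surfaceEDist r x y ≤ 14 := by
  obtain ⟨b, p, hp⟩ := exists_surfaceEDist_carpetPt_le_two r x
  obtain ⟨b', q, hq⟩ := exists_surfaceEDist_carpetPt_le_two r y
  rw [surfaceEDist_comm] at hq
  refine (surfaceEDist_triangle r _ (carpetPt r b p) _).trans ((add_le_add hp
    ((surfaceEDist_triangle r _ (carpetPt r b' q) _).trans (add_le_add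
      (surfaceEDist_carpetPt_carpetPt_le r b b' p q) hq))).trans ?_)
  norm_num

/-- The projections agree, and over the open square so do the copies. Off the slits the fibres are
single points. On a slit, the signed tent separates the two sides except at the endpoints, which the
folds of the pillowcase identify. -/
theorem eq_of_surfaceEDist_eq_zero_carpetPt {b b' : Bool} {p q : Carpet r}
    (h : surfaceEDist r (carpetPt r b p) (carpetPt r b' q) = 0) :
    carpetPt r b p = carpetPt r b' q := by
  have sep : ∀ {Y : Type} [MetricSpace Y] (F : Surface r → Y),
      (∀ x y, edist (F x) (F y) ≤ surfaceEDist r x y) →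
        F (carpetPt r b p) = F (carpetPt r b' q) := fun F hF =>
    edist_le_zero.1 ((hF _ _).trans h.le)
  obtain ⟨P, hP, -, hP'⟩ := exists_surfaceProj r
  have hpq : toPlane r p = toPlane r q := by
    have := sep P hP'
    rw [hP, hP, Prod.mk.injEq] at this
    ext k
    fin_cases k
    · exact this.1
    · exact this.2
  rcases mem_squareBoundary_or_unitSquare r p with hb | hu
  · exact carpetPt_eq_of_boundary r hpq hb
  · obtain ⟨D, hD, hD'⟩ := exists_signed_boundaryDist r
    have hbb : b = b' := by
      have := sep D hD'
      rw [hD, hD, hpq] at this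
      have hpos := boundaryDist_pos (hpq ▸ hu)
      have := mul_right_cancel₀ hpos.ne' this
      cases b <;> cases b' <;> first | rfl | (exfalso; norm_num at this)
    subst hbb
    by_cases hs : ∃ Δ, toPlane r p ∈ slit r Δ
    · obtain ⟨Δ, hΔ⟩ := hs
      obtain ⟨T, hT, -, hT'⟩ := exists_tent r Δ
      have hpT := sep T hT'
      rw [hT, hT] at hpT
      set l := slitLength r Δ with hl
      have hl0 := slitLength_pos r Δ
      set t := toPlane r p 1 - slitBottom r Δ with ht
      have ht' : t ∈ Icc 0 l := ⟨sub_nonneg.2 hΔ.2.1, by linarith [hΔ.2.2]⟩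
      have hz : toPlane r p = slitPt r Δ t := by
        rw [← plane_eta (toPlane r p), slitPt, hΔ.1, ht, add_sub_cancel]
      have hz' : toPlane r q = slitPt r Δ t := hpq ▸ hz
      let s : SlitIndex := (b, Δ)
      let c₁ : Rect (slitLength r s.2) := rectPt l t ⟨by linarith, le_rfl⟩ ht'
      let c₂ : Rect (slitLength r s.2) := rectPt (-l) t ⟨le_rfl, by linarith⟩ ht'
      -- All right lifts of a point are glued to the same point of the pillowcase, so uniqueness of
      -- the lift in the carpet is not needed. The same holds on the left.
      have R : ∀ p, IsRightLift r (slitPt r Δ t) p → pillowPt r s c₁ = carpetPt r b p :=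
        fun p hp => pillowPt_eq_of_right r (s := s) (c := c₁) rfl hp
      have L : ∀ p, IsLeftLift r (slitPt r Δ t) p → pillowPt r s c₂ = carpetPt r b p :=
        fun p hp => pillowPt_eq_of_left r (s := s) (c := c₂) rfl hp
      have hend : tent r Δ (slitPt r Δ t) = -tent r Δ (slitPt r Δ t) →
          pillowPt r s c₁ = pillowPt r s c₂ := by
        intro h
        have h0 : tent r Δ (slitPt r Δ t) = 0 := by linarith
        rw [tent_slitPt r ht'] at h0
        refine pillowPt_eq_of_fold r (neg_neg l).symm rfl ?_
        change t = 0 ∨ t = l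
        rcases min_choice t (l - t) with hm | hm <;> rw [hm] at h0
        · left; linarith
        · right; linarith
      rcases isRightLift_or_isLeftLift r (Δ := Δ) hz rfl with hp | hp <;>
        rcases isRightLift_or_isLeftLift r (Δ := Δ) hz' rfl with hq | hq
      · rw [← R p hp, ← R q hq]
      · rw [carpetTent_of_isRightLift r rfl hp, carpetTent_of_isLeftLift r rfl hq] at hpT
        rw [← R p hp, ← L q hq, hend hpT]
      · rw [carpetTent_of_isLeftLift r rfl hp, carpetTent_of_isRightLift r rfl hq] at hpT
        rw [← L p hp, ← R q hq, hend hpT.symm]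
      · rw [← L p hp, ← L q hq]
    · push Not at hs
      rw [eq_of_toPlane_eq r hpq hu hs]

theorem surface_cases_interior {P : Surface r → Prop} (h1 : ∀ b p, P (carpetPt r b p))
    (h2 : ∀ s (c : Rect (slitLength r s.2)), |c.1 0| < slitLength r s.2 → P (pillowPt r s c))
    (x : Surface r) : P x := by
  induction x using surface_cases with
  | h1 b p => exact h1 b p
  | h2 s c =>
    rcases (abs_le.2 c.2.1).lt_or_eq with h | h
    · exact h2 s c h
    · obtain ⟨p, hp⟩ := exists_carpetPt_eq_pillowPt r h
      rw [hp]
      exact h1 _ _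

/-- Positive depth places `y` in the same pillowcase and determines `|x|`, and the projection
determines the height. The sign of `x` is recovered from `faceFun`, except on the horizontal edges,
where the fold makes it irrelevant. -/
theorem eq_of_surfaceEDist_pillowPt_eq_zero {s : SlitIndex} {c : Rect (slitLength r s.2)}
    (hc : |c.1 0| < slitLength r s.2) {y : Surface r} (h : surfaceEDist r (pillowPt r s c) y = 0) :
    pillowPt r s c = y := by
  have sep : ∀ {Y : Type} [MetricSpace Y] (F : Surface r → Y),
      (∀ x y, edist (F x) (F y) ≤ surfaceEDist r x y) → F (pillowPt r s c) = F y := fun F hF =>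
    edist_le_zero.1 ((hF _ _).trans h.le)
  obtain ⟨E, hE, hE', hE''⟩ := exists_depth r s
  have e1 := sep E hE''
  rw [hE', if_pos rfl] at e1
  induction y using surface_cases with
  | h1 b p =>
    rw [hE] at e1
    linarith
  | h2 s' c' =>
    rw [hE'] at e1
    by_cases hs : s' = s
    · subst hs
      rw [if_pos rfl] at e1
      have e2 : |c.1 0| = |c'.1 0| := by linarith
      obtain ⟨P, -, hP, hP'⟩ := exists_surfaceProj r
      have e3 := sep P hP'
      rw [hP, hP, Prod.mk.injEq] at e3
      have e4 : c.1 1 = c'.1 1 := by linarith [e3.2]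
      obtain ⟨T, -, hT, hT'⟩ := exists_tent r s'.2
      have e5 := sep T hT'
      rw [hT, hT, if_pos rfl, if_pos rfl, faceFun, faceFun, ← e4] at e5
      rcases abs_eq_abs.1 e2 with h0 | h0
      · congr 1
        refine Subtype.ext (PiLp.ext fun k => ?_)
        fin_cases k
        · exact h0
        · exact e4
      · by_cases hm : min (c.1 1) (slitLength r s'.2 - c.1 1) = 0
        · refine pillowPt_eq_of_fold r h0 e4 ?_
          rcases min_choice (c.1 1) (slitLength r s'.2 - c.1 1) with hm' | hm' <;> rw [hm'] at hm
          · left; exact hm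
          · right; linarith
        · congr 1
          refine Subtype.ext (PiLp.ext fun k => ?_)
          fin_cases k
          · have := mul_right_cancel₀ (div_ne_zero hm two_ne_zero) e5
            exact (div_left_inj' (slitLength_pos r s'.2).ne').1 this
          · exact e4
    · rw [if_neg hs] at e1
      linarith

theorem eq_of_surfaceEDist_eq_zero {x y : Surface r} (h : surfaceEDist r x y = 0) : x = y := by
  induction x using surface_cases_interior with
  | h2 s c hc => exact eq_of_surfaceEDist_pillowPt_eq_zero r hc h
  | h1 b p =>
    induction y using surface_cases_interior with
    | h2 s c hc =>
      rw [surfaceEDist_comm] at h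
      exact (eq_of_surfaceEDist_pillowPt_eq_zero r hc h).symm
    | h1 b' q => exact eq_of_surfaceEDist_eq_zero_carpetPt r h

instance : EMetricSpace (Surface r) where
  edist := surfaceEDist r
  edist_self := surfaceEDist_self r
  edist_comm := surfaceEDist_comm r
  edist_triangle := surfaceEDist_triangle r
  eq_of_edist_eq_zero := eq_of_surfaceEDist_eq_zero r

instance : MetricSpace (Surface r) :=
  EMetricSpace.toMetricSpace fun x y => ne_top_of_le_ne_top (by simp) (surfaceEDist_le r x y)

theorem edist_surface (x y : Surface r) : edist x y = surfaceEDist r x y := rfl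

theorem dist_le_dist_surface {Y : Type*} [PseudoMetricSpace Y] {F : Surface r → Y}
    (hF : ∀ x y, edist (F x) (F y) ≤ surfaceEDist r x y) (x y : Surface r) :
    dist (F x) (F y) ≤ dist x y := by
  simpa using (LipschitzWith.of_edist_le hF).dist_le_mul x y

instance : MeasurableSpace (Surface r) := borel _

instance : BorelSpace (Surface r) := ⟨rfl⟩

theorem lipschitzWith_carpetPt (b : Bool) : LipschitzWith 1 (carpetPt r b) :=
  LipschitzWith.of_edist_le (surfaceEDist_carpetPt_le r b)

theorem lipschitzWith_pillowPt (s : SlitIndex) : LipschitzWith 1 (pillowPt r s) :=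
  LipschitzWith.of_edist_le (surfaceEDist_pillowPt_le r s)

/-! ### Lower volume bounds -/

theorem volume_image_le_hausdorffMeasure {F : Surface r → ℝ × ℝ}
    (hF : ∀ x y, edist (F x) (F y) ≤ surfaceEDist r x y) (B : Set (Surface r)) :
    volume (F '' B) ≤ μH[2] B := by
  have := (LipschitzWith.of_edist_le hF).hausdorffMeasure_image_le (d := 2) zero_le_two B
  rw [hausdorffMeasure_prod_real] at this
  simpa using this

theorem volume_irrational_box (a b c d : ℝ) :
    volume ({x | x ∈ Ioo a b ∧ Irrational x} ×ˢ {x | x ∈ Ioo c d ∧ Irrational x}) =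
      ENNReal.ofReal (b - a) * ENNReal.ofReal (d - c) := by
  have h : ∀ a b : ℝ, volume {x | x ∈ Ioo a b ∧ Irrational x} = ENNReal.ofReal (b - a) := by
    intro a b
    rw [← Real.volume_Ioo, ← measure_sdiff_null (s := Ioo a b)
      ((countable_range ((↑) : ℚ → ℝ)).measure_zero volume)]
    rfl
  rw [volume_eq_prod, prod_prod, h, h]

theorem exists_pow_scale {ρ : ℝ} (h0 : 0 < ρ) (h : ρ ≤ 14) :
    ∃ n : ℕ, 5 / 2 ^ n < ρ ∧ ρ / 14 ≤ 1 / 2 ^ n := by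
  have hex : ∃ n : ℕ, (5 : ℝ) / 2 ^ n < ρ :=
    ((tendsto_const_nhds.div_atTop (tendsto_pow_atTop_atTop_of_one_lt
      one_lt_two)).eventually_lt_const h0).exists
  classical
  -- Minimality gives `ρ ≤ 10 / 2 ^ n` when `n > 0`. When `n = 0`, the bound `ρ ≤ 14` is what is
  -- used.
  refine ⟨Nat.find hex, Nat.find_spec hex, ?_⟩
  rcases hn : Nat.find hex with _ | m
  · simp only [pow_zero, div_one]; linarith
  · have := not_lt.1 (Nat.find_min hex (show m < Nat.find hex by omega))
    have e : (5 : ℝ) / 2 ^ m = 10 * (1 / 2 ^ (m + 1)) := by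
      rw [pow_succ]; field_simp; norm_num
    rw [e] at this
    linarith

/-- The ball contains all generic points over some dyadic square of side `2⁻ⁿ ≥ ρ / 14`. Their
projection fills the square up to a null set, whence `196 = 14 ^ 2`. -/
theorem le_hausdorffMeasure_ball_carpetPt (b : Bool) (p : Carpet r) {ρ : ℝ} (h0 : 0 < ρ)
    (h : ρ ≤ 14) : ENNReal.ofReal (ρ ^ 2 / 196) ≤ μH[2] (Metric.ball (carpetPt r b p) ρ) := by
  obtain ⟨n, hn, hn'⟩ := exists_pow_scale h0 h
  obtain ⟨i, j, hij⟩ := exists_openSquare_edist_le r p n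
  obtain ⟨P, hP, -, hP'⟩ := exists_surfaceProj r
  refine le_trans ?_ (volume_image_le_hausdorffMeasure r hP' _)
  have hsub : {x | x ∈ Ioo ((i : ℝ) / 2 ^ n) (((i : ℝ) + 1) / 2 ^ n) ∧ Irrational x} ×ˢ
      {x | x ∈ Ioo ((j : ℝ) / 2 ^ n) (((j : ℝ) + 1) / 2 ^ n) ∧ Irrational x} ⊆
        P '' Metric.ball (carpetPt r b p) ρ := by
    rintro ⟨x, y⟩ ⟨⟨hx, hx'⟩, hy, hy'⟩
    have hg : !₂[x, y] ∈ genericSet := by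
      refine ⟨fun k => ?_, fun k => ?_⟩ <;> fin_cases k
      · exact DyadicSquare.Ioo_subset _ hx
      · exact DyadicSquare.Ioo_subset _ hy
      · exact hx'
      · exact hy'
    refine ⟨carpetPt r b (genericPt r _ hg), ?_, ?_⟩
    · rw [Metric.mem_ball, dist_comm, ← ENNReal.ofReal_lt_ofReal_iff h0, ← edist_dist]
      refine ((surfaceEDist_carpetPt_le r b _ _).trans (hij _ hg ⟨hx, hy⟩)).trans_lt ?_
      exact (ENNReal.ofReal_lt_ofReal_iff h0).2 hn
    · rw [hP, toPlane_genericPt]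
      rfl
  refine le_trans ?_ (measure_mono hsub)
  rw [volume_irrational_box, ← sub_div, ← sub_div, add_sub_cancel_left, add_sub_cancel_left,
    ← ENNReal.ofReal_mul (by positivity)]
  refine ENNReal.ofReal_le_ofReal ?_
  have := mul_le_mul hn' hn' (by positivity) (by positivity)
  linarith

theorem exists_Ioo_subset {l m u : ℝ} (hm : 0 ≤ m) (hml : m ≤ l) (hu : u ∈ Icc 0 l) :
    ∃ α, ∀ x ∈ Ioo α (α + m), x ∈ Icc 0 l ∧ |x - u| ≤ m := by
  rcases le_total m u with h | h
  · refine ⟨u - m, fun x hx => ⟨⟨by linarith [hx.1], by linarith [hx.2, hu.2]⟩, ?_⟩⟩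
    rw [abs_le]; constructor <;> linarith [hx.1, hx.2]
  · refine ⟨0, fun x hx => ⟨⟨hx.1.le, by linarith [hx.2]⟩, ?_⟩⟩
    rw [abs_le]; constructor <;> linarith [hx.1, hx.2, hu.1]

/-- The map (depth, height) sends the ball onto a set containing a square of side `m ≥ ρ / 8`. -/
theorem le_hausdorffMeasure_ball_pillowPt_of_le {s : SlitIndex} (c : Rect (slitLength r s.2)) {ρ : ℝ}
    (h0 : 0 < ρ) (h : ρ ≤ 8 * slitLength r s.2) :
    ENNReal.ofReal (ρ ^ 2 / 64) ≤ μH[2] (Metric.ball (pillowPt r s c) ρ) := by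
  obtain ⟨E, -, hE, hE'⟩ := exists_depth r s
  obtain ⟨P, -, hP, hP'⟩ := exists_surfaceProj r
  have hl : 0 < slitLength r s.2 := slitLength_pos r s.2
  set m := min (ρ / 4) (slitLength r s.2) with hm
  have hm0 : 0 ≤ m := le_min (by linarith) hl.le
  have hmρ : m ≤ ρ / 4 := min_le_left _ _
  have hm8 : ρ / 8 ≤ m := le_min (by linarith) (by linarith)
  have habs : |c.1 0| ≤ slitLength r s.2 := abs_le.2 c.2.1
  obtain ⟨α, hα⟩ := exists_Ioo_subset hm0 (min_le_right _ _)
    (u := slitLength r s.2 - |c.1 0|) ⟨by linarith, by linarith [abs_nonneg (c.1 0)]⟩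
  obtain ⟨β, hβ⟩ := exists_Ioo_subset hm0 (min_le_right _ _) c.2.2
  -- The depth only records `|x|`; the sign `σ` keeps the chosen preimages on the face of `c`.
  obtain ⟨σ, hσ, hσ'⟩ : ∃ σ : ℝ, |σ| = 1 ∧ c.1 0 = σ * |c.1 0| := by
    rcases abs_choice (c.1 0) with h | h
    · exact ⟨1, by simp, by rw [h, one_mul]⟩
    · exact ⟨-1, by simp, by rw [h]; ring⟩
  refine le_trans ?_ (volume_image_le_hausdorffMeasure r (F := fun x => (E x, (P x).2))
    (fun x y => max_le (hE' x y) ((le_max_right _ _).trans (hP' x y))) _)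
  have hsub : Ioo α (α + m) ×ˢ Ioo (slitBottom r s.2 + β) (slitBottom r s.2 + β + m) ⊆
      (fun x => (E x, (P x).2)) '' Metric.ball (pillowPt r s c) ρ := by
    rintro ⟨u, v⟩ ⟨hu, hv⟩
    obtain ⟨hu1, hu2⟩ := hα u hu
    obtain ⟨hv1, hv2⟩ := hβ (v - slitBottom r s.2)
      ⟨by linarith [hv.1], by linarith [hv.2]⟩
    have hlu : |σ * (slitLength r s.2 - u)| = slitLength r s.2 - u := by
      rw [abs_mul, hσ, one_mul, abs_of_nonneg (by linarith [hu1.2])]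
    let c' : Rect (slitLength r s.2) := rectPt (σ * (slitLength r s.2 - u)) (v - slitBottom r s.2)
      (abs_le.1 (hlu.le.trans (by linarith [hu1.1]))) hv1
    refine ⟨pillowPt r s c', ?_, ?_⟩
    · refine lt_of_le_of_lt (((lipschitzWith_pillowPt r s).dist_le_mul c' c).trans ?_)
        (show ρ / 2 < ρ by linarith)
      rw [NNReal.coe_one, one_mul]
      refine (dist_le_abs_add_abs c'.1 c.1).trans ?_
      have e1 : |σ * (slitLength r s.2 - u) - c.1 0| ≤ m := by
        have e : σ * (slitLength r s.2 - u) - c.1 0 =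
            σ * -(u - (slitLength r s.2 - |c.1 0|)) := by
          linear_combination -hσ'
        rwa [e, abs_mul, hσ, one_mul, abs_neg]
      have e2 : |c'.1 1 - c.1 1| ≤ m := hv2
      change |σ * (slitLength r s.2 - u) - c.1 0| + |c'.1 1 - c.1 1| ≤ ρ / 2
      linarith
    · refine Prod.ext ?_ ?_
      · simp only [hE, if_pos]
        change slitLength r s.2 - |σ * (slitLength r s.2 - u)| = u
        rw [hlu]; ring
      · simp only [hP]
        change slitBottom r s.2 + (v - slitBottom r s.2) = v
        ring
  refine le_trans ?_ (measure_mono hsub)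
  rw [volume_eq_prod, prod_prod, Real.volume_Ioo, Real.volume_Ioo, add_sub_cancel_left,
    add_sub_cancel_left, ← ENNReal.ofReal_mul hm0]
  refine ENNReal.ofReal_le_ofReal ?_
  nlinarith

theorem le_hausdorffMeasure_ball (x : Surface r) {ρ : ℝ} (h0 : 0 < ρ) (h : ρ ≤ 14) :
    ENNReal.ofReal (ρ ^ 2 / 784) ≤ μH[2] (Metric.ball x ρ) := by
  have hsq : 0 < ρ ^ 2 := by positivity
  induction x using surface_cases with
  | h1 b p =>
    refine le_trans (ENNReal.ofReal_le_ofReal ?_) (le_hausdorffMeasure_ball_carpetPt r b p h0 h)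
    linarith
  | h2 s c =>
    rcases le_or_gt ρ (8 * slitLength r s.2) with h8 | h8
    · refine le_trans (ENNReal.ofReal_le_ofReal ?_)
        (le_hausdorffMeasure_ball_pillowPt_of_le r c h0 h8)
      linarith
    -- A carpet point lies within `2 l < ρ / 4`, so the ball contains the ball of radius `ρ / 2`
    -- about it. Hence `784 = 4 * 196`.
    · obtain ⟨p, hp⟩ := exists_surfaceEDist_carpetPt_le r s c
      refine le_trans (le_trans (ENNReal.ofReal_le_ofReal ?_) (le_hausdorffMeasure_ball_carpetPt r s.1
        p (half_pos h0) (by linarith))) (measure_mono (Metric.ball_subset_ball' ?_))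
      · exact le_of_eq (by ring)
      · rw [← edist_surface, edist_dist,
          ENNReal.ofReal_le_ofReal_iff (by linarith [slitLength_pos r s.2]), dist_comm] at hp
        linarith

/-! ### Counting dyadic squares near a point -/

open Classical in
/-- The indices of the dyadic squares of generation `n` whose lower left corner is within
`ρ + 2⁻ⁿ` of `(y₀, y₁)` in the supremum norm. -/
def nearSquares (n : ℕ) (y : ℝ × ℝ) (ρ : ℝ) : Finset (Fin (2 ^ n) × Fin (2 ^ n)) :=
  (Finset.univ.filter fun i : Fin (2 ^ n) => |(i : ℝ) / 2 ^ n - y.1| ≤ ρ + 1 / 2 ^ n) ×ˢ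
    Finset.univ.filter fun j : Fin (2 ^ n) => |(j : ℝ) / 2 ^ n - y.2| ≤ ρ + 1 / 2 ^ n

/-- The indices are integers in an interval of length `2 * ρ * 2 ^ n + 2`. -/
theorem card_near_le (n : ℕ) (y : ℝ) {ρ : ℝ} (hρ : 0 ≤ ρ) (T : Finset (Fin (2 ^ n)))
    (hT : ∀ i ∈ T, |(i : ℝ) / 2 ^ n - y| ≤ ρ + 1 / 2 ^ n) :
    (T.card : ℝ) ≤ 2 * ρ * 2 ^ n + 3 := by
  have hp : (0 : ℝ) < 2 ^ n := by positivity
  have hcard : T.card ≤ (Finset.Icc ⌈(y - ρ) * 2 ^ n - 1⌉ ⌊(y + ρ) * 2 ^ n + 1⌋).card := by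
    refine Finset.card_le_card_of_injOn (fun i => ((i : ℕ) : ℤ)) (fun i hi => ?_)
      fun i _ j _ h => Fin.ext (Int.ofNat_inj.1 h)
    have h := hT i hi
    rw [abs_le] at h
    have e : (i : ℝ) / 2 ^ n * 2 ^ n = i := div_mul_cancel₀ _ hp.ne'
    have e' : (1 : ℝ) / 2 ^ n * 2 ^ n = 1 := div_mul_cancel₀ _ hp.ne'
    have h1 := mul_le_mul_of_nonneg_right h.1 hp.le
    have h2 := mul_le_mul_of_nonneg_right h.2 hp.le
    rw [sub_mul, e] at h1 h2
    rw [neg_mul, add_mul, e'] at h1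
    rw [add_mul, e'] at h2
    simp only [Finset.coe_Icc, mem_Icc, Int.ceil_le, Int.le_floor, Int.cast_natCast]
    constructor <;> linarith
  rw [Int.card_Icc] at hcard
  have h1 := Int.floor_le ((y + ρ) * 2 ^ n + 1)
  have h2 := Int.le_ceil ((y - ρ) * 2 ^ n - 1)
  have h0 : 0 ≤ 2 * ρ * 2 ^ n := by positivity
  rcases le_total 0 (⌊(y + ρ) * 2 ^ n + 1⌋ + 1 - ⌈(y - ρ) * 2 ^ n - 1⌉) with h | h
  · have : (T.card : ℤ) ≤ ⌊(y + ρ) * 2 ^ n + 1⌋ + 1 - ⌈(y - ρ) * 2 ^ n - 1⌉ := by omega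
    have : (T.card : ℝ) ≤ ⌊(y + ρ) * 2 ^ n + 1⌋ + 1 - ⌈(y - ρ) * 2 ^ n - 1⌉ := by
      exact_mod_cast this
    linarith
  · have : T.card = 0 := by omega
    rw [this]
    push_cast
    linarith

theorem card_nearSquares_le (n : ℕ) (y : ℝ × ℝ) {ρ : ℝ} (hρ : 0 ≤ ρ) :
    ((nearSquares n y ρ).card : ℝ) ≤ (2 * ρ * 2 ^ n + 3) ^ 2 := by
  rw [nearSquares, Finset.card_product, Nat.cast_mul, sq]
  refine mul_le_mul (card_near_le n y.1 hρ _ fun i hi => ?_) (card_near_le n y.2 hρ _ fun i hi => ?_)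
    (by positivity) (by positivity)
  · simpa using hi
  · simpa using hi

theorem mem_nearSquares {n : ℕ} {y : ℝ × ℝ} {ρ : ℝ} {i j : Fin (2 ^ n)} {a b : ℝ}
    (ha : a ∈ Icc ((i : ℝ) / 2 ^ n) (((i : ℝ) + 1) / 2 ^ n))
    (hb : b ∈ Icc ((j : ℝ) / 2 ^ n) (((j : ℝ) + 1) / 2 ^ n))
    (ha' : |a - y.1| ≤ ρ) (hb' : |b - y.2| ≤ ρ) : (i, j) ∈ nearSquares n y ρ := by
  rw [add_div] at ha hb
  rw [abs_le] at ha' hb'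
  simp only [nearSquares, Finset.mem_product, Finset.mem_filter, Finset.mem_univ, true_and, abs_le]
  refine ⟨⟨?_, ?_⟩, ?_, ?_⟩
  · linarith [ha.2]
  · linarith [ha.1, show (0 : ℝ) ≤ 1 / 2 ^ n by positivity]
  · linarith [hb.2]
  · linarith [hb.1, show (0 : ℝ) ≤ 1 / 2 ^ n by positivity]

theorem abs_sub_floor_lt {a b : ℝ} {K : ℤ} (ha : a = K) (h : |a - b| < 2) : |K - ⌊b⌋| ≤ 3 := by
  rw [abs_lt] at h
  have h1 := Int.floor_le b
  have h2 := Int.lt_floor_add_one b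
  have h3 : (K : ℝ) < ((⌊b⌋ + 3 : ℤ) : ℝ) := by push_cast; linarith
  have h4 : ((⌊b⌋ - 3 : ℤ) : ℝ) < K := by push_cast; linarith
  rw [Int.cast_lt] at h3 h4
  rw [abs_le]
  omega

/-- At scale `2⁻ⁿ` only boundedly many slits of generation less than `n` are near a given point. -/
theorem exists_finset_large_slits (n : ℕ) (y : ℝ × ℝ) {ρ : ℝ} (hρ : ∀ g < n, 2 ^ g * ρ < 1) :
    ∃ T : Finset DyadicSquare, T.card ≤ 49 ∧ ∀ Δ : DyadicSquare, Δ.gen < n →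
      |Δ.centerX - y.1| ≤ ρ → |(Δ.j : ℝ) / 2 ^ Δ.gen - y.2| ≤ ρ + 1 / 2 ^ Δ.gen → Δ ∈ T := by
  set A : Set DyadicSquare := {Δ | Δ.gen < n ∧ |Δ.centerX - y.1| ≤ ρ ∧
    |(Δ.j : ℝ) / 2 ^ Δ.gen - y.2| ≤ ρ + 1 / 2 ^ Δ.gen} with hA
  -- A square is encoded by its centre abscissa in units of `2⁻ⁿ` and by its row, both relative to
  -- `y`. Each entry lies in `[-3, 3]`, whence `49 = 7 ^ 2`. The code is injective because the
  -- abscissa already determines the generation and the column.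
  let f : DyadicSquare → ℤ × ℤ := fun Δ =>
    (⌊Δ.centerX * 2 ^ n⌋ - ⌊y.1 * 2 ^ n⌋, (Δ.j : ℤ) - ⌊y.2 * 2 ^ Δ.gen⌋)
  have hfloor : ∀ Δ ∈ A, Δ.centerX * 2 ^ n = (⌊Δ.centerX * 2 ^ n⌋ : ℝ) := by
    rintro Δ ⟨hg, -⟩
    obtain ⟨K, hK⟩ := Δ.exists_centerX_eq hg
    rw [hK, div_mul_cancel₀ _ (by positivity), Int.floor_natCast, Int.cast_natCast]
  have hmaps : MapsTo f A ((Finset.Icc (-3) 3 ×ˢ Finset.Icc (-3) 3 : Finset (ℤ × ℤ)) : Set (ℤ × ℤ)) := by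
    intro Δ hΔ
    obtain ⟨hg, hx, hy⟩ := hΔ
    simp only [Finset.coe_product, Finset.coe_Icc, mem_prod, mem_Icc, ← abs_le, f]
    constructor
    · refine abs_sub_floor_lt (hfloor Δ ⟨hg, hx, hy⟩) ?_
      obtain ⟨m, rfl⟩ : ∃ m, n = m + 1 := ⟨n - 1, by omega⟩
      rw [← sub_mul, abs_mul, abs_of_pos (show (0 : ℝ) < 2 ^ (m + 1) by positivity)]
      -- The hypothesis for the last generation below `n` gives `2 ^ n * ρ < 2`.
      have := hρ m (by omega)
      calc |Δ.centerX - y.1| * 2 ^ (m + 1) ≤ ρ * 2 ^ (m + 1) := by gcongr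
        _ = 2 * (2 ^ m * ρ) := by ring
        _ < 2 := by linarith
    · refine abs_sub_floor_lt (a := (Δ.j : ℝ)) (by simp) ?_
      have hp : (0 : ℝ) < 2 ^ Δ.gen := by positivity
      have e : (Δ.j : ℝ) - y.2 * 2 ^ Δ.gen = ((Δ.j : ℝ) / 2 ^ Δ.gen - y.2) * 2 ^ Δ.gen := by
        rw [sub_mul, div_mul_cancel₀ _ hp.ne']
      rw [e, abs_mul, abs_of_pos hp]
      calc |(Δ.j : ℝ) / 2 ^ Δ.gen - y.2| * 2 ^ Δ.gen ≤ (ρ + 1 / 2 ^ Δ.gen) * 2 ^ Δ.gen := by gcongr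
        _ = 2 ^ Δ.gen * ρ + 1 := by field_simp
        _ < 2 := by linarith [hρ _ hg]
  have hinj : InjOn f A := by
    intro Δ hΔ Δ' hΔ' h
    simp only [f, Prod.mk.injEq] at h
    have hK : ⌊Δ.centerX * 2 ^ n⌋ = ⌊Δ'.centerX * 2 ^ n⌋ := by linarith [h.1]
    have hx : Δ.centerX = Δ'.centerX := by
      have := hfloor Δ hΔ
      rw [hK, ← hfloor Δ' hΔ'] at this
      exact mul_right_cancel₀ (by positivity) this
    obtain ⟨hg, hi⟩ := DyadicSquare.eq_of_centerX_eq hx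
    refine DyadicSquare.ext_of_eq hg hi ?_
    have h2 := h.2
    simp only [hg] at h2
    omega
  have hfin : A.Finite := Set.Finite.of_injOn hmaps hinj (Finset.finite_toSet _)
  refine ⟨hfin.toFinset, ?_, fun Δ h1 h2 h3 => hfin.mem_toFinset.2 ⟨h1, h2, h3⟩⟩
  refine (Finset.card_le_card_of_injOn f (fun Δ hΔ => hmaps (hfin.mem_toFinset.1 hΔ))
    (fun Δ hΔ Δ' hΔ' => hinj (hfin.mem_toFinset.1 hΔ) (hfin.mem_toFinset.1 hΔ'))).trans ?_
  simp

/-! ### Upper volume bounds -/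

/-- At generation `n` at most `(2 ρ 2ⁿ + 3)²` pieces of diameter at most `5 / 2 ^ n` are needed. The
sum of squared diameters is bounded by a quantity tending to `25 * (2 ρ)² = 100 ρ²`. -/
theorem hausdorffMeasure_carpet_le (b : Bool) (y : ℝ × ℝ) {ρ : ℝ} (hρ : 0 ≤ ρ) :
    μH[2] (carpetPt r b '' {p | |toPlane r p 0 - y.1| ≤ ρ ∧ |toPlane r p 1 - y.2| ≤ ρ}) ≤
      ENNReal.ofReal (100 * ρ ^ 2) := by
  have hlim0 : Tendsto (fun n : ℕ => (1 : ℝ) / 2 ^ n) atTop (𝓝 0) :=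
    tendsto_const_nhds.div_atTop (tendsto_pow_atTop_atTop_of_one_lt one_lt_two)
  have hdiam : ∀ n (x : {x // x ∈ nearSquares n y ρ}),
      Metric.ediam (carpetPt r b '' squareCarpet r ⟨n, x.1.1, x.1.2⟩) ≤
        ENNReal.ofReal (5 * (1 / 2 ^ n)) := fun n x => by
    refine ((lipschitzWith_carpetPt r b).ediam_image_le _).trans ?_
    rw [ENNReal.coe_one, one_mul, mul_one_div]
    exact ediam_squareCarpet_le r _
  refine (hausdorffMeasure_le_liminf_sum (ι := fun n => {x // x ∈ nearSquares n y ρ}) 2 _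
    (l := atTop) (fun n : ℕ => ENNReal.ofReal (5 * (1 / 2 ^ n))) ?_
    (fun n x => carpetPt r b '' squareCarpet r ⟨n, x.1.1, x.1.2⟩)
    (Eventually.of_forall hdiam) (Eventually.of_forall fun n => ?_)).trans ?_
  · simpa using ENNReal.tendsto_ofReal (hlim0.const_mul 5)
  · rintro _ ⟨p, ⟨h0, h1⟩, rfl⟩
    obtain ⟨i, j, hij⟩ := exists_mem_squareCarpet r p n
    have := toPlane_of_mem_squareCarpet r hij
    exact mem_iUnion.2 ⟨⟨(i, j), mem_nearSquares this.1 this.2 h0 h1⟩, p, hij, rfl⟩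
  · have hle : ∀ n : ℕ, ∑ x : {x // x ∈ nearSquares n y ρ},
        Metric.ediam (carpetPt r b '' squareCarpet r ⟨n, x.1.1, x.1.2⟩) ^ (2 : ℝ) ≤
          ENNReal.ofReal (25 * (2 * ρ + 3 * (1 / 2 ^ n)) ^ 2) := fun n => by
      have h1 : ∀ x : {x // x ∈ nearSquares n y ρ},
          Metric.ediam (carpetPt r b '' squareCarpet r ⟨n, x.1.1, x.1.2⟩) ^ (2 : ℝ) ≤
            ENNReal.ofReal ((5 * (1 / 2 ^ n)) ^ 2) := fun x => by
        rw [ENNReal.rpow_two, ENNReal.ofReal_pow (by positivity)]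
        gcongr
        exact hdiam n x
      refine (Finset.sum_le_sum fun x _ => h1 x).trans ?_
      rw [Finset.sum_const, Finset.card_univ, Fintype.card_coe, nsmul_eq_mul,
        ← ENNReal.ofReal_natCast, ← ENNReal.ofReal_mul (by positivity)]
      refine ENNReal.ofReal_le_ofReal ?_
      calc ((nearSquares n y ρ).card : ℝ) * (5 * (1 / 2 ^ n)) ^ 2
          ≤ (2 * ρ * 2 ^ n + 3) ^ 2 * (5 * (1 / 2 ^ n)) ^ 2 := by
            gcongr; exact card_nearSquares_le n y hρ
        _ = 25 * (2 * ρ + 3 * (1 / 2 ^ n)) ^ 2 := by field_simp; ring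
    refine (liminf_le_liminf (Eventually.of_forall hle)).trans (le_of_eq (Tendsto.liminf_eq ?_))
    have := (((hlim0.const_mul 3).const_add (2 * ρ)).pow 2).const_mul 25
    refine ENNReal.tendsto_ofReal ?_
    convert this using 2
    ring

theorem hausdorffMeasure_pillow_le (s : SlitIndex) {A : Set (Rect (slitLength r s.2))}
    {a w e h : ℝ} (hw : 0 ≤ w) (hA : ∀ c ∈ A, c.1 0 ∈ Icc a (a + w) ∧ c.1 1 ∈ Icc e (e + h)) :
    μH[2] (pillowPt r s '' A) ≤ ENNReal.ofReal (4 * (w * h)) := by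
  have hl : 0 < slitLength r s.2 := slitLength_pos r s.2
  have hl' : -(slitLength r s.2) ≤ slitLength r s.2 := by linarith
  let f : ℝ × ℝ → Surface r := fun x => pillowPt r s
    (rectPt (projIcc _ _ hl' x.1) (projIcc _ _ hl.le x.2) (projIcc _ _ hl' x.1).2
      (projIcc _ _ hl.le x.2).2)
  -- From the supremum metric to the Euclidean one, estimated through the sum of the coordinate
  -- differences; squaring gives the factor `4`.
  have hf : LipschitzWith 2 f := by
    refine LipschitzWith.of_dist_le_mul fun x y => ?_
    refine ((lipschitzWith_pillowPt r s).dist_le_mul _ _).trans ?_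
    rw [NNReal.coe_one, one_mul]
    refine (dist_le_abs_add_abs _ _).trans ?_
    have h1 : dist (projIcc _ _ hl' x.1) (projIcc _ _ hl' y.1) ≤ dist x y :=
      ((LipschitzWith.projIcc hl').dist_le_mul x.1 y.1).trans (by simp [Prod.dist_eq])
    have h2 : dist (projIcc _ _ hl.le x.2) (projIcc _ _ hl.le y.2) ≤ dist x y :=
      ((LipschitzWith.projIcc hl.le).dist_le_mul x.2 y.2).trans (by simp [Prod.dist_eq])
    rw [Subtype.dist_eq, Real.dist_eq] at h1 h2
    refine (add_le_add h1 h2).trans (le_of_eq ?_)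
    rw [NNReal.coe_ofNat]
    ring
  have hsub : pillowPt r s '' A ⊆ f '' (Icc a (a + w) ×ˢ Icc e (e + h)) := by
    rintro _ ⟨c, hc, rfl⟩
    refine ⟨(c.1 0, c.1 1), hA c hc, ?_⟩
    simp only [f]
    congr 1
    refine Subtype.ext ?_
    simp only [rectPt, projIcc_of_mem _ c.2.1, projIcc_of_mem _ c.2.2]
    exact plane_eta c.1
  refine (measure_mono hsub).trans ((hf.hausdorffMeasure_image_le zero_le_two _).trans ?_)
  rw [hausdorffMeasure_prod_real, volume_eq_prod, prod_prod, Real.volume_Icc, Real.volume_Icc,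
    add_sub_cancel_left, add_sub_cancel_left, ENNReal.rpow_two, ← ENNReal.ofReal_mul hw,
    ENNReal.ofReal_mul zero_le_four]
  norm_num

theorem hausdorffMeasure_pillow_le_length (s : SlitIndex) (A : Set (Rect (slitLength r s.2))) :
    μH[2] (pillowPt r s '' A) ≤ ENNReal.ofReal (8 * slitLength r s.2 ^ 2) := by
  have hl := slitLength_pos r s.2
  refine (hausdorffMeasure_pillow_le r s (A := A) (a := -slitLength r s.2)
    (w := 2 * slitLength r s.2) (e := 0) (h := slitLength r s.2) (by linarith) fun c _ =>
    ⟨⟨c.2.1.1, by linarith [c.2.1.2]⟩, ⟨c.2.2.1, by linarith [c.2.2.2]⟩⟩).trans (le_of_eq ?_)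
  ring_nf

/-- Depth and height vary by at most `2 ρ` around one point of the set. It therefore lies in two
boxes of side `4 ρ`, one for each face, and `128 = 2 * 4 * 16`. -/
theorem hausdorffMeasure_pillow_ball_le (s : SlitIndex) (x : Surface r) {ρ : ℝ} (hρ : 0 < ρ) :
    μH[2] (pillowPt r s '' {c | pillowPt r s c ∈ Metric.ball x ρ}) ≤
      ENNReal.ofReal (128 * ρ ^ 2) := by
  set A := {c | pillowPt r s c ∈ Metric.ball x ρ} with hA
  rcases A.eq_empty_or_nonempty with h | ⟨c, hc⟩
  · rw [h]; simp
  obtain ⟨E, -, hE, hE'⟩ := exists_depth r s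
  obtain ⟨P, -, hP, hP'⟩ := exists_surfaceProj r
  have hd : ∀ c' ∈ A, |abs (c'.1 0) - abs (c.1 0)| ≤ 2 * ρ ∧ |c'.1 1 - c.1 1| ≤ 2 * ρ := by
    intro c' hc'
    have hdist : dist (pillowPt r s c') (pillowPt r s c) ≤ 2 * ρ := by
      have h1 := dist_triangle_right (pillowPt r s c') (pillowPt r s c) x
      have h2 : dist (pillowPt r s c') x < ρ := hc'
      have h3 : dist (pillowPt r s c) x < ρ := hc
      linarith
    constructor
    · have := (dist_le_dist_surface r hE' (pillowPt r s c') (pillowPt r s c)).trans hdist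
      rwa [hE, hE, if_pos rfl, if_pos rfl, Real.dist_eq, sub_sub_sub_cancel_left,
        abs_sub_comm] at this
    · have := (dist_le_dist_surface r hP' (pillowPt r s c') (pillowPt r s c)).trans hdist
      rw [hP, hP, Prod.dist_eq] at this
      simpa [Real.dist_eq] using (le_max_right _ _).trans this
  set k := |c.1 0| with hk
  have hsplit : A = {c' | c' ∈ A ∧ 0 ≤ c'.1 0} ∪ {c' | c' ∈ A ∧ c'.1 0 < 0} := by
    ext c'
    constructor
    · exact fun h => (le_or_gt 0 (c'.1 0)).imp (fun h' => ⟨h, h'⟩) fun h' => ⟨h, h'⟩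
    · rintro (h | h) <;> exact h.1
  rw [hsplit, image_union]
  refine (measure_union_le _ _).trans ((add_le_add
    (hausdorffMeasure_pillow_le r s (a := k - 2 * ρ) (w := 4 * ρ) (e := c.1 1 - 2 * ρ) (h := 4 * ρ)
      (by linarith) fun c' h => ?_)
    (hausdorffMeasure_pillow_le r s (a := -k - 2 * ρ) (w := 4 * ρ) (e := c.1 1 - 2 * ρ) (h := 4 * ρ)
      (by linarith) fun c' h => ?_)).trans ?_)
  · obtain ⟨h1, h2⟩ := hd c' h.1
    rw [abs_of_nonneg h.2] at h1
    rw [abs_le] at h1 h2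
    exact ⟨⟨by linarith, by linarith⟩, ⟨by linarith, by linarith⟩⟩
  · obtain ⟨h1, h2⟩ := hd c' h.1
    rw [abs_of_neg h.2] at h1
    rw [abs_le] at h1 h2
    exact ⟨⟨by linarith, by linarith⟩, ⟨by linarith, by linarith⟩⟩
  · rw [← ENNReal.ofReal_add (by positivity) (by positivity)]
    exact le_of_eq (by ring_nf)

theorem hausdorffMeasure_ball_le (hr : Summable fun n => (r n : ℝ) ^ 2) (x : Surface r) {ρ : ℝ}
    (hρ : 0 < ρ) :
    μH[2] (Metric.ball x ρ) ≤ ENNReal.ofReal ((12744 + 400 * ∑' n, (r n : ℝ) ^ 2) * ρ ^ 2) := by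
  obtain ⟨P, hP, hP', hP''⟩ := exists_surfaceProj r
  set y := P x
  set B := Metric.ball x ρ
  have hy : ∀ z ∈ B, |(P z).1 - y.1| ≤ ρ ∧ |(P z).2 - y.2| ≤ ρ := by
    intro z hz
    have h1 := (dist_le_dist_surface r hP'' z x).trans (Metric.mem_ball.1 hz).le
    rw [Prod.dist_eq, max_le_iff] at h1
    exact h1
  have hex : ∃ n : ℕ, 1 ≤ 2 ^ n * ρ :=
    (((tendsto_pow_atTop_atTop_of_one_lt one_lt_two).atTop_mul_const hρ).eventually_ge_atTop 1).exists
  classical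
  -- The threshold generation: `2⁻ⁿ ≤ ρ`, while every smaller generation has `2⁻ᵍ > ρ`.
  set n := Nat.find hex
  obtain ⟨T, hT, hT'⟩ := exists_finset_large_slits n y
    (fun g hg => not_le.1 (Nat.find_min hex hg))
  let A : ∀ s : SlitIndex, Set (Rect (slitLength r s.2)) := fun s => {c | pillowPt r s c ∈ B}
  let small : Bool → ℕ → Set (Surface r) := fun b g => if n ≤ g then
    ⋃ x ∈ nearSquares g y ρ, pillowPt r (b, ⟨g, x.1, x.2⟩) '' A (b, ⟨g, x.1, x.2⟩) else ∅
  let part : Bool → Set (Surface r) := fun b =>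
    carpetPt r b '' {p | |toPlane r p 0 - y.1| ≤ ρ ∧ |toPlane r p 1 - y.2| ≤ ρ} ∪
      ((⋃ Δ ∈ T, pillowPt r (b, Δ) '' A (b, Δ)) ∪ ⋃ g, small b g)
  have hcover : B ⊆ part false ∪ part true := by
    suffices h : ∀ z ∈ B, ∃ b, z ∈ part b by
      intro z hz
      obtain ⟨b, hb⟩ := h z hz
      cases b
      · exact Or.inl hb
      · exact Or.inr hb
    intro z hz
    have hz' := hy z hz
    induction z using surface_cases with
    | h1 b p =>
      rw [hP] at hz'
      exact ⟨b, Or.inl ⟨p, hz', rfl⟩⟩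
    | h2 s c =>
      rw [hP'] at hz'
      obtain ⟨b, Δ⟩ := s
      -- The projection of a pillowcase point lies on its slit, hence in its dyadic square; being
      -- close to `y`, it makes that square a near one.
      have hs := slitPt_mem_slit r c.2.2
      have ho := slit_subset_openSquare r Δ hs
      have hnear : (Δ.i, Δ.j) ∈ nearSquares Δ.gen y ρ :=
        mem_nearSquares (Ioo_subset_Icc_self ho.1) (Ioo_subset_Icc_self ho.2) hz'.1 hz'.2
      refine ⟨b, Or.inr ?_⟩
      rcases le_or_gt n Δ.gen with hg | hg
      · refine Or.inr (mem_iUnion.2 ⟨Δ.gen, ?_⟩)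
        simp only [small, if_pos hg]
        exact mem_iUnion₂.2 ⟨(Δ.i, Δ.j), hnear, c, hz, rfl⟩
      · simp only [nearSquares, Finset.mem_product, Finset.mem_filter, Finset.mem_univ,
          true_and] at hnear
        exact Or.inl (mem_iUnion₂.2 ⟨Δ, hT' Δ hg hz'.1 hnear.2, c, hz, rfl⟩)
  -- `6272 = 49 * 128`.
  have hlarge : ∀ b, μH[2] (⋃ Δ ∈ T, pillowPt r (b, Δ) '' A (b, Δ)) ≤
      ENNReal.ofReal (6272 * ρ ^ 2) := by
    intro b
    refine (measure_biUnion_finset_le _ _).trans ((Finset.sum_le_sum fun Δ _ =>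
      hausdorffMeasure_pillow_ball_le r (b, Δ) x hρ).trans ?_)
    rw [Finset.sum_const, nsmul_eq_mul, ← ENNReal.ofReal_natCast,
      ← ENNReal.ofReal_mul (by positivity)]
    refine ENNReal.ofReal_le_ofReal ?_
    have : (T.card : ℝ) ≤ 49 := by exact_mod_cast hT
    nlinarith [sq_nonneg ρ]
  have hsmall : ∀ b g, μH[2] (small b g) ≤ ENNReal.ofReal (200 * ρ ^ 2 * (r g : ℝ) ^ 2) := by
    intro b g
    by_cases hg : n ≤ g
    · simp only [small, if_pos hg]
      refine (measure_biUnion_finset_le _ _).trans ((Finset.sum_le_sum fun x _ =>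
        hausdorffMeasure_pillow_le_length r (b, ⟨g, x.1, x.2⟩) _).trans ?_)
      -- Beyond the threshold the `3` in the count is absorbed: `2 ρ 2ᵍ + 3 ≤ 5 ρ 2ᵍ`. The powers of
      -- `2ᵍ` then cancel against the area of the pillowcases, leaving `25 * 8 * ρ² * r_g²`.
      have h1 : 1 ≤ 2 ^ g * ρ := (Nat.find_spec hex).trans (by
        gcongr
        exact one_le_two)
      simp only [slitLength]
      rw [Finset.sum_const, nsmul_eq_mul, ← ENNReal.ofReal_natCast,
        ← ENNReal.ofReal_mul (by positivity)]
      refine ENNReal.ofReal_le_ofReal ?_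
      calc ((nearSquares g y ρ).card : ℝ) * (8 * ((r g : ℝ) / 2 ^ g) ^ 2)
          ≤ (2 * ρ * 2 ^ g + 3) ^ 2 * (8 * ((r g : ℝ) / 2 ^ g) ^ 2) := by
            gcongr; exact card_nearSquares_le g y hρ.le
        _ ≤ (5 * (2 ^ g * ρ)) ^ 2 * (8 * ((r g : ℝ) / 2 ^ g) ^ 2) := by
            gcongr; linarith
        _ = 200 * ρ ^ 2 * (r g : ℝ) ^ 2 := by field_simp; ring
    · simp [small, if_neg hg]
  have hsum : ∀ b, μH[2] (⋃ g, small b g) ≤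
      ENNReal.ofReal (200 * ρ ^ 2 * ∑' n, (r n : ℝ) ^ 2) := by
    intro b
    refine (measure_iUnion_le _).trans ((ENNReal.tsum_le_tsum (hsmall b)).trans (le_of_eq ?_))
    rw [← tsum_mul_left, ENNReal.ofReal_tsum_of_nonneg (fun g => by positivity) (hr.mul_left _)]
  have hS : 0 ≤ ∑' n, (r n : ℝ) ^ 2 := tsum_nonneg fun n => sq_nonneg _
  -- `6372 = 100 + 6272`, the carpet and the large slits of one copy; the two copies together give
  -- `12744` and `400`.
  have hpart : ∀ b, μH[2] (part b) ≤
      ENNReal.ofReal ((6372 + 200 * ∑' n, (r n : ℝ) ^ 2) * ρ ^ 2) := by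
    intro b
    refine (measure_union_le _ _).trans ((add_le_add (hausdorffMeasure_carpet_le r b y hρ.le)
      ((measure_union_le _ _).trans (add_le_add (hlarge b) (hsum b)))).trans (le_of_eq ?_))
    rw [← ENNReal.ofReal_add (by positivity) (by positivity),
      ← ENNReal.ofReal_add (by positivity) (by positivity)]
    congr 1
    ring
  refine (measure_mono hcover).trans ((measure_union_le _ _).trans
    ((add_le_add (hpart false) (hpart true)).trans (le_of_eq ?_)))
  rw [← ENNReal.ofReal_add (by positivity) (by positivity)]
  congr 1
  ring

end SlitCarpet

end

/-- If `r ∈ ℓ²`, then `d_𝒟` is a metric on the glued surface `𝒟`, and `𝒟` with this metric is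
Ahlfors `2`-regular. -/
theorem mainTheorem8 (r : ℕ → Set.Ioo (0 : ℝ) 1) (hr : Summable fun n => (r n : ℝ) ^ 2) :
    ∃ m : MetricSpace (SlitCarpet.Surface r),
      (∀ p q, @edist _ m.toPseudoMetricSpace.toEDist p q = SlitCarpet.surfaceEDist r p q) ∧
      @SlitCarpet.IsAhlforsRegular 2 (SlitCarpet.Surface r) m := by
  have hS : 0 ≤ ∑' n, (r n : ℝ) ^ 2 := tsum_nonneg fun n => sq_nonneg _
  -- The constant exceeds both `784`, from the lower bound, and `12744 + 400 * ∑' n, (r n : ℝ) ^ 2`,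
  -- from the upper one.
  refine ⟨inferInstance, SlitCarpet.edist_surface r, 13600 + 400 * ∑' n, (r n : ℝ) ^ 2, ?_, ?_⟩
  · linarith
  intro p ρ hρ hd
  -- The lower bound is available only up to radius `14`, which bounds the diameter of the surface.
  have h14 : ρ ≤ 14 := by
    have h : ENNReal.ofReal ρ ≤ 14 :=
      hd.trans (Metric.ediam_le fun x _ y _ => SlitCarpet.surfaceEDist_le r x y)
    simpa using h
  rw [Real.rpow_two]
  constructor
  · refine le_trans (ENNReal.ofReal_le_ofReal ?_) (SlitCarpet.le_hausdorffMeasure_ball r p hρ h14)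
    gcongr
    linarith
  · refine (SlitCarpet.hausdorffMeasure_ball_le r hr p hρ).trans (ENNReal.ofReal_le_ofReal ?_)
    gcongr
    linarith
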